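/- **Setting.** A *Jordan domain* is a nonempty connected open set $U\subset\mathbb C$ whose boundary in the Riemann sphere $\hat{\mathbb C}$ is a Jordan curve. The class $\mathcal B_{\log}$ consists of all maps $F:\mathcal T\to H$, where $\mathcal T,H\subset\mathbb C$, such that: 1. $H$ is a $2\pi i$-periodic Jordan domain that contains a right half-plane; 2. every connected component $T$ of $\mathcal T$ (called a *tract*) is a Jordan domain with real parts bounded below but unbounded above; 3. distinct tracts have disjoint closures, and the tracts accumulate only at $\infty$ (every bounded set meets only finitely many tracts); 4. $F:T\to H$ is a conformal isomorphism for every tract $T$, and $F$ extends continuously, with values in $\mathbb C$, to the closure $\overline{\mathcal T}$ of $\mathcal T$ in $\mathbb C$ (the extension is again denoted $F$); 5. $\exp$ is injective on every tract; 6. $\mathcal T$ is invariant under translation by $2\pi i$. For $F\in\mathcal B_{\log}$ let $J(F)$ be the set of all $z\in\overline{\mathcal T}$ such that $F^{n}(z)$ is defined and in $\overline{\mathcal T}$ for all $n\ge 0$. Let $I(F)=\{z\in J(F):\operatorname{Re}F^{n}(z)\to+\infty\}$ be the set of escaping points, and for $K>0$ let $J^K(F)=\{z\in J(F):\operatorname{Re}F^{n}(z)\ge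 K\text{ for all }n\ge1\}$. $F$ is of *disjoint type* if $\overline{\mathcal T}\subset H$. An *external address* is any sequence $\underline s=T_0T_1T_2\dots$ of tracts, and $J_{\underline s}=\{z\in J(F): F^{n}(z)\in\overline{T_n}\text{ for all }n\ge 0\}$. Let $\varphi:\mathbb R\to\mathbb R$ be continuous and (not necessarily strictly) increasing with $\varphi(x)>x$ for all $x$. An external address $\underline s$ satisfies the head-start condition for $\varphi$ if - for all $k\ge0$ and all $z,w\in\overline{T_k}$ with $F(z),F(w)\in\overline{T_{k+1}}$: if $\operatorname{Re}w>\varphi(\operatorname{Re}z)$, then $\operatorname{Re}F(w)>\varphi(\operatorname{Re}F(z))$; and - for all distinct $z,w\in J_{\underline s}$ there is $M\ge 0$ with $\operatorname{Re}F^{M}(z)>\varphi(\operatorname{Re}F^{M}(w))$ or $\operatorname{Re}F^{M}(w)>\varphi(\operatorname{Re}F^{M}(z))$. $F$ satisfies a *head-start condition* if every external address satisfies the head-start condition for some such $\varphi$ (possibly depending on the address), and the *uniform* head-start condition for $\varphi$ if every external address satisfies it for this one $\varphi$. **Theorem (Existence of Absorbing Brush).** Suppose that $F\in\mathcal B_{\log}$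 satisfies a head-start condition. Then there exists a closed set $X\subset J(F)$ with the following properties. (a) $F(X)\subset X$. (b) Each connected component $C$ of $X$ is a closed arc to infinity, i.e. $C=\gamma([0,\infty))$ for a continuous injective curve $\gamma:[0,\infty)\to\mathbb C$ with $\gamma(t)\to\infty$ as $t\to\infty$, and all points of $C$ except possibly the finite endpoint $\gamma(0)$ escape, i.e. $\gamma(t)\in I(F)$ for all $t>0$. (c) For every $z\in I(F)$ there is $n\ge0$ with $F^{n}(z)\in X$. If $F$ satisfies the uniform head-start condition for some function, then there is $K'>0$ with $J^{K'}(F)\subset X$. (d) If $\exp\circ F$ is $2\pi i$-periodic on $\mathcal T$ (as it is for every logarithmic transform, i.e. whenever $\exp\circ F=f\circ\exp$ for some function $f$), then $X$ is $2\pi i$-periodic. If, additionally, $F$ is of disjoint type, then $X=J(F)$ has all these properties. -/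

import Mathlib

open Set Filter Topology

/-- A Jordan domain, possibly unbounded: a nonempty connected open subset of the plane whose
boundary, taken in the Riemann sphere `ℂ ∪ {∞}`, is a Jordan curve. -/
def IsJordanDomain (U : Set ℂ) : Prop :=
  IsOpen U ∧ IsConnected U ∧
    ∃ γ : Circle → OnePoint ℂ, Continuous γ ∧ Function.Injective γ ∧
      range γ = frontier ((fun z : ℂ => (z : OnePoint ℂ)) '' U)

/-- Invariance of a set under translation by `2πi` (in both directions). -/
def IsTwoPiIPeriodic (A : Set ℂ) : Prop :=
  ∀ z : ℂ, z + 2 * Real.pi * Complex.I ∈ A ↔ z ∈ A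

/-- The tracts: the connected components of the domain `𝒯`. -/
def tracts (𝒯 : Set ℂ) : Set (Set ℂ) :=
  {T | ∃ z ∈ 𝒯, T = connectedComponentIn 𝒯 z}

/-- `F : 𝒯 → H` belongs to the class `B_log`. The map is given as a total function `ℂ → ℂ`, which
on `closure 𝒯` is the continuous extension of `F : 𝒯 → H`; its values off `closure 𝒯` are
irrelevant and are never used. -/
structure IsBLog (F : ℂ → ℂ) (𝒯 H : Set ℂ) : Prop where
  /-- `H` is a `2πi`-periodic Jordan domain containing a right half plane. -/
  jordan_range : IsJordanDomain H
  periodic_range : IsTwoPiIPeriodic H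
  halfPlane_subset : ∃ R : ℝ, {z : ℂ | R < z.re} ⊆ H
  /-- Every tract is an unbounded Jordan domain with real parts bounded below, but unbounded
  above. -/
  jordan_tract : ∀ T ∈ tracts 𝒯, IsJordanDomain T
  re_bddBelow : ∀ T ∈ tracts 𝒯, BddBelow (Complex.re '' T)
  re_not_bddAbove : ∀ T ∈ tracts 𝒯, ¬ BddAbove (Complex.re '' T)
  /-- The tracts have disjoint closures. -/
  disjoint_closure : ∀ T ∈ tracts 𝒯, ∀ T' ∈ tracts 𝒯, T ≠ T' →
    Disjoint (closure T) (closure T')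
  /-- The tracts accumulate only at infinity: points of pairwise different tracts tend to
  infinity, that is, each disc meets only finitely many tracts. -/
  locally_finite : ∀ R : ℝ, {T ∈ tracts 𝒯 | (T ∩ Metric.ball 0 R).Nonempty}.Finite
  /-- On every tract `F` is a conformal isomorphism onto `H`. -/
  holomorphic : ∀ T ∈ tracts 𝒯, DifferentiableOn ℂ F T
  bijective : ∀ T ∈ tracts 𝒯, BijOn F T H
  /-- `F` is extended continuously, with finite values, to the closure of `𝒯` in `ℂ`. -/
  continuous_closure : ContinuousOn F (closure 𝒯)
  /-- The exponential map is injective on every tract. -/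
  exp_injective : ∀ T ∈ tracts 𝒯, InjOn Complex.exp T
  /-- `𝒯` is invariant under translation by `2πi`. -/
  periodic_domain : IsTwoPiIPeriodic 𝒯

/-- `F` descends under `exp`: `exp ∘ F` is `2πi`-periodic on `𝒯`, i.e. `F(z + 2πi) - F(z)` is a
multiple of `2πi`. Every logarithmic transform (`exp ∘ F = f ∘ exp`) has this property. -/
def DescendsUnderExp (F : ℂ → ℂ) (𝒯 : Set ℂ) : Prop :=
  ∀ z ∈ 𝒯, Complex.exp (F (z + 2 * Real.pi * Complex.I)) = Complex.exp (F z)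

/-- The Julia set: the points all of whose iterates are defined and lie in `closure 𝒯`. -/
def juliaSet (F : ℂ → ℂ) (𝒯 : Set ℂ) : Set ℂ :=
  {z | ∀ n : ℕ, F^[n] z ∈ closure 𝒯}

/-- The set `I(F)` of escaping points. -/
def escapingSet (F : ℂ → ℂ) (𝒯 : Set ℂ) : Set ℂ :=
  {z ∈ juliaSet F 𝒯 | Tendsto (fun n : ℕ => (F^[n] z).re) atTop atTop}

/-- The set `J^K(F)`. -/
def juliaSetAbove (F : ℂ → ℂ) (𝒯 : Set ℂ) (K : ℝ) : Set ℂ :=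
  {z ∈ juliaSet F 𝒯 | ∀ n : ℕ, 1 ≤ n → K ≤ (F^[n] z).re}

/-- External addresses: arbitrary sequences of tracts. -/
def IsExternalAddress (𝒯 : Set ℂ) (s : ℕ → Set ℂ) : Prop :=
  ∀ n : ℕ, s n ∈ tracts 𝒯

/-- The set `J_s` of points of the Julia set with external address `s`. -/
def juliaSetAt (F : ℂ → ℂ) (𝒯 : Set ℂ) (s : ℕ → Set ℂ) : Set ℂ :=
  {z ∈ juliaSet F 𝒯 | ∀ n : ℕ, F^[n] z ∈ closure (s n)}

/-- The functions admitted in head-start conditions. -/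
def IsHeadStartFunction (φ : ℝ → ℝ) : Prop :=
  Monotone φ ∧ Continuous φ ∧ ∀ x : ℝ, x < φ x

/-- The head-start condition for `φ` for a pair of tracts `(T, T')`. -/
def PairHeadStart (F : ℂ → ℂ) (φ : ℝ → ℝ) (T T' : Set ℂ) : Prop :=
  ∀ z ∈ closure T, ∀ w ∈ closure T, F z ∈ closure T' → F w ∈ closure T' →
    φ z.re < w.re → φ (F z).re < (F w).re

/-- The head-start condition for `φ` for an external address `s`. -/
def AddressHeadStart (F : ℂ → ℂ) (𝒯 : Set ℂ) (φ : ℝ → ℝ) (s : ℕ → Set ℂ) : Prop :=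
  (∀ k : ℕ, PairHeadStart F φ (s k) (s (k + 1))) ∧
    ∀ z ∈ juliaSetAt F 𝒯 s, ∀ w ∈ juliaSetAt F 𝒯 s, z ≠ w →
      ∃ M : ℕ, φ (F^[M] w).re < (F^[M] z).re ∨ φ (F^[M] z).re < (F^[M] w).re

/-- `F` satisfies a head-start condition: each external address does so for some `φ`, which may
depend on the address. -/
def HeadStart (F : ℂ → ℂ) (𝒯 : Set ℂ) : Prop :=
  ∀ s : ℕ → Set ℂ, IsExternalAddress 𝒯 s →
    ∃ φ : ℝ → ℝ, IsHeadStartFunction φ ∧ AddressHeadStart F 𝒯 φ s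

/-- `F` satisfies the uniform head-start condition for `φ`. -/
def UniformHeadStart (F : ℂ → ℂ) (𝒯 : Set ℂ) (φ : ℝ → ℝ) : Prop :=
  IsHeadStartFunction φ ∧
    ∀ s : ℕ → Set ℂ, IsExternalAddress 𝒯 s → AddressHeadStart F 𝒯 φ s

/-- `F` is of disjoint type. -/
def IsDisjointType (𝒯 H : Set ℂ) : Prop := closure 𝒯 ⊆ H

/-- `C` is a closed arc to infinity, i.e. the image of a continuous injective curve
`γ : [0, ∞) → ℂ` with `γ(t) → ∞`, and all its points, except possibly the finite endpoint `γ(0)`,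
are in `E`. -/
def IsArcToInfinityIn (C E : Set ℂ) : Prop :=
  ∃ γ : ℝ → ℂ, ContinuousOn γ (Ici 0) ∧ InjOn γ (Ici 0) ∧ γ '' Ici 0 = C ∧
    Tendsto γ atTop (cocompact ℂ) ∧ ∀ t : ℝ, 0 < t → γ t ∈ E

/-- `X` is an absorbing brush for `F`. -/
structure IsAbsorbingBrush (F : ℂ → ℂ) (𝒯 X : Set ℂ) : Prop where
  subset_julia : X ⊆ juliaSet F 𝒯
  closed : IsClosed X
  periodic : DescendsUnderExp F 𝒯 → IsTwoPiIPeriodic X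
  forward_invariant : MapsTo F X X
  component_arc : ∀ z ∈ X, IsArcToInfinityIn (connectedComponentIn X z) (escapingSet F 𝒯)
  absorbs : ∀ z ∈ escapingSet F 𝒯, ∃ n : ℕ, F^[n] z ∈ X
  uniform_absorbs : (∃ φ : ℝ → ℝ, UniformHeadStart F 𝒯 φ) →
    ∃ K' : ℝ, 0 < K' ∧ juliaSetAbove F 𝒯 K' ⊆ X

/-! Fix a closed set D ⊆ H. Let X consist of the points of J(F) whose orbits stay in D from time 1
on, and which are connected to ∞ on the sphere through points of the same kind: this is
`componentAtInfty (controlledSet F 𝒯 D)`. In general D is a half-plane Re z ≥ K with K large; for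
disjoint type D is the closure of 𝒯, and X turns out to be all of J(F).

Arcs. Closed tracts are disjoint and locally finite, so a connected subset of X has a single address
s. By the head-start condition, "at some time the orbit of w has a head start over that of z" is a
strict total order on the points with address s. With ∞ added as largest point, it is an open
relation on the relevant continuum. A weighted sum of running maxima of the heights arctan Re F^k is
then a continuous strictly increasing function, so the continuum is an interval and the component an
arc to ∞ (`exists_strictMono_continuous`, `isArcToInfinityIn_of_slower`).

Escape. A tract contains no disc of radius greater than 7, because exp is injective on it. A weak
Bloch theorem therefore bounds the derivatives of the inverse branches H → T. Far to the right they
are contractions. For disjoint type, the tracts keep a positive distance from the complement of H,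
and pulling back enlarges holomorphic discs by a definite factor; this replaces expansion of the
hyperbolic metric. In both cases two different orbits with the same address cannot both return
infinitely often to the same left half-plane (`OrbitsSeparate`). Hence the faster of two points
escapes, and only the slowest point of an arc may fail to do so.

Absorption. If the orbit of z stays far enough to the right, take in the n-th tract an unbounded
continuum that begins at the real part of F^n(z), and pull it back n times. The head-start condition
keeps the pullbacks in D, and forces the pulled-back initial points to accumulate at z; the limit of
the continua joins z to ∞ (`mem_componentAtInfty_of_headStart`). For disjoint type whole closed
tracts can be pulled back. -/

/-! ### Nested continua and boundary bumping. -/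

section Continua

variable {X : Type*} [TopologicalSpace X] [T2Space X]

/-- A splitting of the intersection into two closed pieces can be thickened to disjoint open sets.
By compactness these already cover, and so disconnect, some `A n`. -/
theorem isPreconnected_iInter_of_antitone {A : ℕ → Set X} (hA : Antitone A)
    (hc : ∀ n, IsCompact (A n)) (hp : ∀ n, IsPreconnected (A n)) :
    IsPreconnected (⋂ n, A n) := by
  rw [isPreconnected_closed_iff]
  intro t t' ht ht' hsub ⟨x, hx, hxt⟩ ⟨y, hy, hyt⟩
  by_contra hne
  have hcl : IsCompact (⋂ n, A n) :=
    (hc 0).of_isClosed_subset (isClosed_iInter fun n => (hc n).isClosed) (iInter_subset A 0)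
  have hdisj : Disjoint ((⋂ n, A n) ∩ t) ((⋂ n, A n) ∩ t') := by
    rw [Set.disjoint_left]
    rintro z ⟨hz, hz1⟩ ⟨-, hz2⟩
    exact hne ⟨z, hz, hz1, hz2⟩
  obtain ⟨U, V, hU, hV, hPU, hQV, hUV⟩ :=
    SeparatedNhds.of_isCompact_isCompact (hcl.inter_right ht) (hcl.inter_right ht') hdisj
  have hdir : Directed (· ⊇ ·) A := hA.directed_ge
  obtain ⟨n, hn⟩ : ∃ n, A n ⊆ U ∪ V := by
    refine exists_subset_nhds_of_isCompact' hdir hc (fun n => (hc n).isClosed) ?_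
    intro z hz
    rcases hsub hz with h | h
    · exact (hU.union hV).mem_nhds (Or.inl (hPU ⟨hz, h⟩))
    · exact (hU.union hV).mem_nhds (Or.inr (hQV ⟨hz, h⟩))
  obtain ⟨z, -, hzU, hzV⟩ := hp n U V hU hV hn
    ⟨x, mem_iInter.1 hx n, hPU ⟨hx, hxt⟩⟩ ⟨y, mem_iInter.1 hy n, hQV ⟨hy, hyt⟩⟩
  exact Set.disjoint_left.1 hUV hzU hzV

/-- Limits of points of continua through `a` lie in the component of `a` of the limit set. -/
theorem mem_connectedComponentIn_iInter {W A : ℕ → Set X} (hW : Antitone W)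
    (hc : ∀ n, IsCompact (W n)) (hAW : ∀ n, A n ⊆ W n) (hA : ∀ n, IsPreconnected (A n))
    {a b : X} (ha : ∀ n, a ∈ A n) (hb : ∀ n, b ∈ closure (⋃ m ≥ n, A m)) :
    b ∈ connectedComponentIn (⋂ n, W n) a := by
  have hsub : ∀ n, closure (⋃ m ≥ n, A m) ⊆ W n := fun n =>
    closure_minimal (iUnion₂_subset fun m hm => (hAW m).trans (hW hm)) (hc n).isClosed
  have haL : ∀ n, a ∈ closure (⋃ m ≥ n, A m) := fun n =>
    subset_closure (mem_iUnion₂.2 ⟨n, le_rfl, ha n⟩)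
  have hp : IsPreconnected (⋂ n, closure (⋃ m ≥ n, A m)) := by
    refine isPreconnected_iInter_of_antitone ?_ (fun n => (hc n).of_isClosed_subset
      isClosed_closure (hsub n)) fun n => ?_
    · intro m n hmn
      exact closure_mono (iUnion₂_subset fun k hk => subset_iUnion₂_of_subset k (hmn.trans hk)
        subset_rfl)
    · refine IsPreconnected.closure ?_
      refine isPreconnected_of_forall a fun y hy => ?_
      obtain ⟨m, hm, hym⟩ := mem_iUnion₂.1 hy
      exact ⟨A m, subset_iUnion₂_of_subset m hm subset_rfl, ha m, hym, hA m⟩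
  exact hp.subset_connectedComponentIn (mem_iInter.2 haL)
    (iInter_mono hsub) (mem_iInter.2 hb)

/-- Boundary bumping: a component of `M ∩ E` of a continuum `M ⊄ E` leaves any
relatively open subset `O` of `E`. -/
theorem exists_mem_connectedComponentIn_notMem {M E O : Set X} (hM : IsCompact M)
    (hMp : IsPreconnected M) (hE : IsClosed (M ∩ E)) (hO : IsClosed (M \ O)) (hOE : M ∩ O ⊆ E)
    (hne : ¬ M ⊆ E) {a : X} (ha : a ∈ M ∩ E) :
    ∃ b ∈ connectedComponentIn (M ∩ E) a, b ∉ O := by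
  by_contra! hcon
  have hN : IsCompact (M ∩ E) := hM.of_isClosed_subset hE inter_subset_left
  have : CompactSpace (M ∩ E : Set X) := isCompact_iff_compactSpace.1 hN
  let a' : (M ∩ E : Set X) := ⟨a, ha⟩
  have hcomp : connectedComponent a' ⊆ (fun x : (M ∩ E : Set X) => (x : X)) ⁻¹' O := by
    intro y hy
    refine hcon _ ?_
    rw [connectedComponentIn_eq_image ha]
    exact ⟨y, hy, rfl⟩
  have hOo : IsOpen ((fun x : (M ∩ E : Set X) => (x : X)) ⁻¹' O) := by
    have : (fun x : (M ∩ E : Set X) => (x : X)) ⁻¹' O =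
        ((fun x : (M ∩ E : Set X) => (x : X)) ⁻¹' (M \ O))ᶜ := by
      ext y
      simp [y.2.1]
    rw [this]
    exact (hO.preimage continuous_subtype_val).isOpen_compl
  -- In a compact Hausdorff space components are quasi-components, so a component inside the open
  -- set `O` has a clopen neighbourhood `P` inside `O`.
  rw [connectedComponent_eq_iInter_isClopen] at hcomp
  obtain ⟨⟨P, hP, haP⟩, hPO⟩ : ∃ P : {s : Set (M ∩ E : Set X) // IsClopen s ∧ a' ∈ s},
      P.1 ⊆ (fun x : (M ∩ E : Set X) => (x : X)) ⁻¹' O := by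
    have : Nonempty {s : Set (M ∩ E : Set X) // IsClopen s ∧ a' ∈ s} :=
      ⟨⟨univ, isClopen_univ, mem_univ _⟩⟩
    refine exists_subset_nhds_of_compactSpace ?_ (fun s => s.2.1.1)
      (fun x hx => hOo.mem_nhds (hcomp hx))
    intro s t
    exact ⟨⟨s.1 ∩ t.1, s.2.1.inter t.2.1, s.2.2, t.2.2⟩, inter_subset_left, inter_subset_right⟩
  have hcP : IsClosed ((fun x : (M ∩ E : Set X) => (x : X)) '' P) :=
    (hE.isClosedEmbedding_subtypeVal).isClosedMap _ hP.1
  have hcPc : IsClosed ((fun x : (M ∩ E : Set X) => (x : X)) '' Pᶜ) :=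
    (hE.isClosedEmbedding_subtypeVal).isClosedMap _ hP.compl.1
  obtain ⟨y, hyM, hyE⟩ := not_subset.1 hne
  rw [isPreconnected_closed_iff] at hMp
  -- `P` and `Pᶜ ∪ (M \ O)` are closed, disjoint and cover `M`. Both are nonempty, contrary to
  -- connectedness of `M`.
  obtain ⟨z, hzM, ⟨w, hwP, rfl⟩, hz⟩ := hMp _ _ hcP (hcPc.union hO)
    (by
      intro x hx
      by_cases hxO : x ∈ O
      · by_cases hxP : (⟨x, hx, hOE ⟨hx, hxO⟩⟩ : (M ∩ E : Set X)) ∈ P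
        · exact Or.inl ⟨_, hxP, rfl⟩
        · exact Or.inr (Or.inl ⟨_, hxP, rfl⟩)
      · exact Or.inr (Or.inr ⟨hx, hxO⟩))
    ⟨a, ha.1, a', haP, rfl⟩ ⟨y, hyM, Or.inr ⟨hyM, fun h => hyE (hOE ⟨hyM, h⟩)⟩⟩
  rcases hz with ⟨v, hv, hvw⟩ | hz
  · exact hv (Subtype.val_injective hvw ▸ hwP)
  · exact hz.2 (hPO hwP)

end Continua

/-! ### Ordered continua as real intervals. -/

section LinearContinua

variable {α : Type*} [TopologicalSpace α] [LinearOrder α] [OrderClosedTopology α]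
  [CompactSpace α]

/-- The topology is not assumed to be the order topology; only closedness of `≤` and compactness
enter. The set where the running maximum is at least c is the closed ray above the least point of
the compact set {g ≥ c}. -/
theorem continuous_sSup_image_Iic [PreconnectedSpace α] {g : α → ℝ} (hg : Continuous g) :
    Continuous fun w => sSup (g '' Iic w) := by
  have hcpt : ∀ w : α, IsCompact (g '' Iic w) := fun w => isClosed_Iic.isCompact.image hg
  have hbdd : ∀ w : α, BddAbove (g '' Iic w) := fun w => (hcpt w).bddAbove
  have hne : ∀ w : α, (g '' Iic w).Nonempty := fun w => ⟨g w, w, le_rfl, rfl⟩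
  rw [OrderTopology.continuous_iff]
  intro c
  constructor
  · rw [isOpen_iff_mem_nhds]
    intro w hw
    obtain ⟨_, ⟨u, hu, rfl⟩, hcu⟩ := exists_lt_of_lt_csSup (hne w) hw
    have key : ∃ S : Set α, S ∈ 𝓝 w ∧ ∀ v ∈ S, ∃ u' ≤ v, c < g u' := by
      by_cases huw : u < w
      · exact ⟨Ioi u, isOpen_Ioi.mem_nhds huw, fun v hv => ⟨u, le_of_lt hv, hcu⟩⟩
      have huw' : u = w := le_antisymm hu (not_lt.1 huw)
      subst huw'
      by_cases hmin : ∃ v ∈ g ⁻¹' Ioi c, v < u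
      · obtain ⟨v, hv, hvu⟩ := hmin
        exact ⟨Ioi v, isOpen_Ioi.mem_nhds hvu, fun x hx => ⟨v, le_of_lt hx, hv⟩⟩
      push Not at hmin
      -- Here `u` is the least point at which `g` exceeds `c`, which makes the closed ray above it
      -- open.
      have hopen : IsOpen (Ici u) := by
        have : Ici u = (g ⁻¹' Ioi c) ∪ Ioi u := by
          ext x
          constructor
          · intro hx
            rcases eq_or_lt_of_le (show u ≤ x from hx) with h | h
            · exact Or.inl (h ▸ hcu)
            · exact Or.inr h
          · rintro (h | h)
            · exact hmin x h
            · exact le_of_lt h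
        rw [this]
        exact (isOpen_Ioi.preimage hg).union isOpen_Ioi
      exact ⟨Ici u, hopen.mem_nhds le_rfl, fun v hv => ⟨u, hv, hcu⟩⟩
    obtain ⟨S, hS, hS'⟩ := key
    filter_upwards [hS] with v hv
    obtain ⟨u', hu', hc⟩ := hS' v hv
    exact lt_csSup_of_lt (hbdd v) ⟨u', hu', rfl⟩ hc
  · have hset : ((fun w => sSup (g '' Iic w)) ⁻¹' Iio c)ᶜ = {w | ∃ u ≤ w, c ≤ g u} := by
      ext w
      simp only [mem_compl_iff, mem_preimage, mem_Iio, not_lt, mem_ofPred_eq]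
      constructor
      · intro h
        obtain ⟨u, hu, hgu⟩ := (hcpt w).sSup_mem (hne w)
        exact ⟨u, hu, by rw [hgu]; exact h⟩
      · rintro ⟨u, hu, hcu⟩
        exact hcu.trans (le_csSup (hbdd w) ⟨u, hu, rfl⟩)
    rw [← isClosed_compl_iff, hset]
    have hB : IsCompact (g ⁻¹' Ici c) := (isClosed_Ici.preimage hg).isCompact
    rcases (g ⁻¹' Ici c).eq_empty_or_nonempty with h | h
    · convert isClosed_empty using 1
      ext w
      simp only [mem_ofPred_eq, mem_empty_iff_false, iff_false, not_exists, not_and]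
      intro u _ hcu
      have : u ∈ g ⁻¹' Ici c := hcu
      simp [h] at this
    · obtain ⟨b, hb, hbl⟩ : ∃ b ∈ g ⁻¹' Ici c, ∀ x ∈ g ⁻¹' Ici c, b ≤ x := by
        obtain ⟨b, hb⟩ := hB.exists_isLeast h
        exact ⟨b, hb.1, fun x hx => hb.2 hx⟩
      convert isClosed_Ici (a := b) using 1
      ext w
      exact ⟨fun ⟨u, hu, hcu⟩ => (hbl u hcu).trans hu, fun hw => ⟨b, hw, hb⟩⟩

/-- Running maxima make each `g k` monotone. The separation hypothesis says precisely that between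
`u` and `w` one of these maxima strictly increases, so the sum with weights 2^(-k) is strictly
increasing; the uniform bound gives uniform convergence. -/
theorem exists_strictMono_continuous [PreconnectedSpace α] {g : ℕ → α → ℝ}
    (hg : ∀ k, Continuous (g k)) (hb : ∀ k u, |g k u| ≤ 2)
    (hsep : ∀ u w : α, u < w → ∃ k, ∀ v ≤ u, g k v < g k w) :
    ∃ f : α → ℝ, Continuous f ∧ StrictMono f := by
  have hcpt : ∀ k, ∀ w : α, IsCompact (g k '' Iic w) := fun k w =>
    isClosed_Iic.isCompact.image (hg k)
  have hbdd : ∀ k, ∀ w : α, BddAbove (g k '' Iic w) := fun k w => (hcpt k w).bddAbove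
  have hne : ∀ k, ∀ w : α, (g k '' Iic w).Nonempty := fun k w => ⟨g k w, w, le_rfl, rfl⟩
  set M : ℕ → α → ℝ := fun k w => sSup (g k '' Iic w) with hM
  have hMmono : ∀ k, Monotone (M k) := fun k u w huw =>
    csSup_le_csSup (hbdd k w) (hne k u) (image_mono (Iic_subset_Iic.2 huw))
  have hMb : ∀ k w, ‖(1 / 2 : ℝ) ^ k * M k w‖ ≤ 2 * (1 / 2) ^ k := by
    intro k w
    obtain ⟨u, -, hu⟩ := (hcpt k w).sSup_mem (hne k w)
    have : |M k w| ≤ 2 := by rw [hM]; simp only; rw [← hu]; exact hb k u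
    rw [norm_mul, Real.norm_eq_abs, Real.norm_eq_abs, abs_of_nonneg (by positivity), mul_comm]
    gcongr
  have hsum : Summable fun k : ℕ => 2 * (1 / 2 : ℝ) ^ k :=
    (summable_geometric_of_lt_one (by norm_num) (by norm_num)).mul_left 2
  have hsumM : ∀ w, Summable fun k => (1 / 2 : ℝ) ^ k * M k w := fun w =>
    Summable.of_norm_bounded hsum fun k => hMb k w
  refine ⟨fun w => ∑' k, (1 / 2 : ℝ) ^ k * M k w, ?_, ?_⟩
  · exact continuous_tsum (fun k => (continuous_sSup_image_Iic (hg k)).const_mul _) hsum hMb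
  · intro u w huw
    obtain ⟨k, hk⟩ := hsep u w huw
    refine Summable.tsum_lt_tsum (i := k) (fun j => ?_) ?_ (hsumM u) (hsumM w)
    · exact mul_le_mul_of_nonneg_left (hMmono j huw.le) (by positivity)
    · refine mul_lt_mul_of_pos_left ?_ (by positivity)
      obtain ⟨v, hv, hgv⟩ := (hcpt k u).sSup_mem (hne k u)
      calc M k u = g k v := hgv.symm
        _ < g k w := hk v hv
        _ ≤ M k w := le_csSup (hbdd k w) ⟨w, le_rfl, rfl⟩

/-- `f` is an embedding onto a compact interval by compactness and connectedness. Its inverse,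
composed with a homeomorphism from [0, ∞) onto the interval without its right endpoint, is the ray.
-/
theorem exists_ray_parametrization [PreconnectedSpace α] {f : α → ℝ} (hf : Continuous f)
    (hmono : StrictMono f) {p : α} (htop : ∀ u, u ≤ p) (hp : ∃ u, u ≠ p) :
    ∃ γ : ℝ → α, ContinuousOn γ (Ici 0) ∧ InjOn γ (Ici 0) ∧ γ '' Ici 0 = {p}ᶜ ∧
      Tendsto γ atTop (𝓝 p) ∧ ∀ t, 0 < t → γ 0 < γ t := by
  have : Nonempty α := ⟨p⟩
  obtain ⟨m, hm⟩ : ∃ m : α, ∀ u, m ≤ u := by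
    obtain ⟨b, hb⟩ := (isCompact_univ (X := α)).exists_isLeast ⟨p, mem_univ _⟩
    exact ⟨b, fun x => hb.2 (mem_univ x)⟩
  obtain ⟨u₀, hu₀⟩ := hp
  have hmp : m < p := lt_of_le_of_lt (hm u₀) (lt_of_le_of_ne (htop u₀) hu₀)
  set a := f m with ha
  set b := f p with hbdef
  have hab : a < b := hmono hmp
  have hemb := hf.isClosedEmbedding hmono.injective
  have hrange : ∀ x, x ∈ Icc a b → x ∈ range f := by
    intro x hx
    have := isPreconnected_univ.intermediate_value (mem_univ m) (mem_univ p) hf.continuousOn hx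
    obtain ⟨y, -, hy⟩ := this
    exact ⟨y, hy⟩
  set g := Function.invFun f with hg
  have hfg : ∀ x ∈ Icc a b, f (g x) = x := fun x hx => Function.invFun_eq (hrange x hx)
  have hgf : ∀ u, g (f u) = u := Function.leftInverse_invFun hmono.injective
  have hgc : ContinuousOn g (Icc a b) := by
    rw [hemb.isInducing.continuousOn_iff]
    exact continuousOn_id.congr hfg
  set h : ℝ → ℝ := fun t => b - (b - a) / (1 + t) with hh
  have hmaps : ∀ t ∈ Ici (0 : ℝ), h t ∈ Icc a b ∧ h t < b := by
    intro t ht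
    have ht0 : (0 : ℝ) ≤ t := ht
    have h1 : 0 < (b - a) / (1 + t) := div_pos (by linarith) (by linarith)
    have h2 : (b - a) / (1 + t) ≤ b - a := div_le_self (by linarith) (by linarith)
    exact ⟨⟨by simp only [hh]; linarith, by simp only [hh]; linarith⟩, by simp only [hh]; linarith⟩
  have hcont : ContinuousOn h (Ici 0) := by
    refine continuousOn_const.sub (continuousOn_const.div (by fun_prop) ?_)
    intro t ht
    have ht0 : (0 : ℝ) ≤ t := ht
    linarith
  have hmonoh : StrictMonoOn h (Ici 0) := by
    intro s hs t ht hst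
    have hs0 : (0 : ℝ) ≤ s := hs
    have : (b - a) / (1 + t) < (b - a) / (1 + s) :=
      div_lt_div_of_pos_left (by linarith) (by linarith) (by linarith)
    simp only [hh]; linarith
  have hγmono : StrictMonoOn (fun t => g (h t)) (Ici 0) := by
    intro s hs t ht hst
    rw [← hmono.lt_iff_lt, hfg _ (hmaps s hs).1, hfg _ (hmaps t ht).1]
    exact hmonoh hs ht hst
  refine ⟨fun t => g (h t), hgc.comp hcont fun t ht => (hmaps t ht).1, hγmono.injOn, ?_, ?_, ?_⟩
  · ext u
    constructor
    · rintro ⟨t, ht, rfl⟩ hup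
      have hup' : g (h t) = p := hup
      have := hfg _ (hmaps t ht).1
      rw [hup'] at this
      exact absurd this (ne_of_gt (hmaps t ht).2)
    · intro hu
      have hub : f u < b := hmono (lt_of_le_of_ne (htop u) hu)
      have hau : a ≤ f u := hmono.monotone (hm u)
      refine ⟨(b - a) / (b - f u) - 1, ?_, ?_⟩
      · have : 1 ≤ (b - a) / (b - f u) := by
          rw [le_div_iff₀ (by linarith)]; linarith
        exact sub_nonneg.2 this
      · have : h ((b - a) / (b - f u) - 1) = f u := by
          have h1 : b - f u ≠ 0 := by linarith
          have h2 : b - a ≠ 0 := by linarith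
          simp only [hh]
          rw [show 1 + ((b - a) / (b - f u) - 1) = (b - a) / (b - f u) by ring,
            div_div_cancel₀ h2]
          ring
        simp only [this, hgf]
  · have h1 : Tendsto h atTop (𝓝[Icc a b] b) := by
      refine tendsto_nhdsWithin_iff.2 ⟨?_, ?_⟩
      · have : Tendsto (fun t : ℝ => (b - a) / (1 + t)) atTop (𝓝 0) :=
          tendsto_const_nhds.div_atTop (tendsto_atTop_add_const_left _ _ tendsto_id)
        simpa [hh] using tendsto_const_nhds (x := b).sub this
      · filter_upwards [eventually_ge_atTop 0] with t ht using (hmaps t ht).1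
    have h2 := (hgc b ⟨hab.le, le_rfl⟩).tendsto.comp h1
    rwa [hgf p] at h2
  · intro t ht
    exact hγmono (mem_Ici.2 le_rfl) (mem_Ici.2 ht.le) ht

end LinearContinua

/-! ### Connectedness to ∞ on the sphere. -/

/-- The set `A ∪ {∞}` in the Riemann sphere. -/
def withInfty (A : Set ℂ) : Set (OnePoint ℂ) :=
  insert OnePoint.infty ((fun z : ℂ => (z : OnePoint ℂ)) '' A)

section WithInfty

theorem infty_mem_withInfty (A : Set ℂ) : OnePoint.infty ∈ withInfty A := mem_insert _ _

@[simp] theorem coe_mem_withInfty {A : Set ℂ} {z : ℂ} :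
    (z : OnePoint ℂ) ∈ withInfty A ↔ z ∈ A := by
  simp [withInfty]

theorem withInfty_mono {A B : Set ℂ} (h : A ⊆ B) : withInfty A ⊆ withInfty B :=
  insert_subset_insert (image_mono h)

theorem coe_preimage_withInfty (A : Set ℂ) :
    (fun z : ℂ => (z : OnePoint ℂ)) ⁻¹' withInfty A = A := by
  ext z; simp

theorem isClosed_withInfty {A : Set ℂ} (hA : IsClosed A) : IsClosed (withInfty A) := by
  rw [OnePoint.isClosed_iff_of_mem (infty_mem_withInfty A)]
  exact (coe_preimage_withInfty A).symm ▸ hA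

theorem withInfty_iInter (A : ℕ → Set ℂ) : withInfty (⋂ n, A n) = ⋂ n, withInfty (A n) := by
  ext u
  induction u using OnePoint.rec with
  | infty => simp [infty_mem_withInfty]
  | coe z => simp

/-- The part of `A` that lies, on the sphere, in the component of `∞` of `A ∪ {∞}`. -/
def componentAtInfty (A : Set ℂ) : Set ℂ :=
  {z | (z : OnePoint ℂ) ∈ connectedComponentIn (withInfty A) OnePoint.infty}

theorem componentAtInfty_subset (A : Set ℂ) : componentAtInfty A ⊆ A := fun _ hz =>
  coe_mem_withInfty.1 (connectedComponentIn_subset _ _ hz)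

theorem componentAtInfty_mono {A B : Set ℂ} (h : A ⊆ B) :
    componentAtInfty A ⊆ componentAtInfty B := fun _ hz =>
  connectedComponentIn_mono _ (withInfty_mono h) hz

theorem withInfty_componentAtInfty (A : Set ℂ) :
    withInfty (componentAtInfty A) = connectedComponentIn (withInfty A) OnePoint.infty := by
  ext u
  induction u using OnePoint.rec with
  | infty =>
    exact iff_of_true (infty_mem_withInfty _) (mem_connectedComponentIn (infty_mem_withInfty _))
  | coe z => exact coe_mem_withInfty

theorem isPreconnected_withInfty_componentAtInfty (A : Set ℂ) :
    IsPreconnected (withInfty (componentAtInfty A)) :=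
  withInfty_componentAtInfty A ▸ isPreconnected_connectedComponentIn

theorem subset_componentAtInfty {A B : Set ℂ} (hB : IsPreconnected (withInfty B)) (h : B ⊆ A) :
    B ⊆ componentAtInfty A := fun _ hz =>
  hB.subset_connectedComponentIn (infty_mem_withInfty B) (withInfty_mono h)
    (coe_mem_withInfty.2 hz)

theorem isClosed_componentAtInfty {A : Set ℂ} (hA : IsClosed A) :
    IsClosed (componentAtInfty A) := by
  have h : IsClosed (connectedComponentIn (withInfty A) OnePoint.infty) := by
    refine isClosed_of_closure_subset ?_
    refine (isPreconnected_connectedComponentIn.closure).subset_connectedComponentIn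
      (subset_closure (mem_connectedComponentIn (infty_mem_withInfty A))) ?_
    exact closure_minimal (connectedComponentIn_subset _ _) (isClosed_withInfty hA)
  exact h.preimage OnePoint.continuous_coe

theorem isPreconnected_withInfty {A : Set ℂ} (hA : IsPreconnected A)
    (hunb : ¬ Bornology.IsBounded A) : IsPreconnected (withInfty A) := by
  refine (hA.image _ OnePoint.continuous_coe.continuousOn).subset_closure (subset_insert _ _) ?_
  refine insert_subset ?_ subset_closure
  rw [mem_closure_iff_nhds]
  intro S hS
  have h1 : (fun z : ℂ => (z : OnePoint ℂ)) ⁻¹' S ∈ cocompact ℂ := by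
    rw [← coclosedCompact_eq_cocompact, ← OnePoint.comap_coe_nhds_infty]
    exact preimage_mem_comap hS
  rw [mem_cocompact] at h1
  obtain ⟨C, hC, hCS⟩ := h1
  obtain ⟨z, hzA, hzC⟩ : ∃ z ∈ A, z ∉ C := by
    by_contra! h
    exact hunb (hC.isBounded.subset h)
  exact ⟨z, hCS hzC, z, hzA, rfl⟩

theorem continuousOn_onePoint_elim {β : Type*} [TopologicalSpace β] {h : ℂ → β} {E : Set ℂ} {y : β}
    (hc : ContinuousOn h E) (ht : Tendsto h (cocompact ℂ ⊓ 𝓟 E) (𝓝 y)) :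
    ContinuousOn (fun u : OnePoint ℂ => u.elim y h) (withInfty E) := by
  intro u hu
  induction u using OnePoint.rec with
  | infty =>
    intro S hS
    have h2 := ht hS
    rw [mem_map, mem_inf_principal, ← coclosedCompact_eq_cocompact,
      ← OnePoint.comap_coe_nhds_infty, mem_comap] at h2
    obtain ⟨V, hV, hVS⟩ := h2
    rw [mem_map, mem_nhdsWithin_iff_exists_mem_nhds_inter]
    refine ⟨V, hV, ?_⟩
    rintro v ⟨hvV, hvE⟩
    induction v using OnePoint.rec with
    | infty => exact (mem_of_mem_nhds hS : y ∈ S)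
    | coe z => exact hVS hvV (coe_mem_withInfty.1 hvE)
  | coe z =>
    have hz := hc z (coe_mem_withInfty.1 hu)
    rw [ContinuousWithinAt, OnePoint.nhdsWithin_coe, coe_preimage_withInfty, tendsto_map'_iff]
    exact hz

theorem continuousOn_onePoint_map {h : ℂ → ℂ} {E : Set ℂ} (hc : ContinuousOn h E)
    (ht : Tendsto h (cocompact ℂ ⊓ 𝓟 E) (cocompact ℂ)) :
    ContinuousOn (OnePoint.map h) (withInfty E) := by
  have h1 : OnePoint.map h =
      fun u : OnePoint ℂ => u.elim OnePoint.infty fun z => ((h z : ℂ) : OnePoint ℂ) := by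
    funext u
    induction u using OnePoint.rec <;> rfl
  rw [h1]
  refine continuousOn_onePoint_elim (OnePoint.continuous_coe.comp_continuousOn hc) ?_
  rw [← coclosedCompact_eq_cocompact (X := ℂ)] at ht ⊢
  exact OnePoint.tendsto_coe_infty.comp ht

theorem isPreconnected_withInfty_image {h : ℂ → ℂ} {E : Set ℂ} (hc : ContinuousOn h E)
    (ht : Tendsto h (cocompact ℂ ⊓ 𝓟 E) (cocompact ℂ)) (hE : IsPreconnected (withInfty E)) :
    IsPreconnected (withInfty (h '' E)) := by
  have := hE.image _ (continuousOn_onePoint_map hc ht)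
  convert this using 1
  simp [withInfty, image_insert_eq, image_image]

theorem mapsTo_componentAtInfty {h : ℂ → ℂ} {A B : Set ℂ} (hc : ContinuousOn h A)
    (ht : Tendsto h (cocompact ℂ ⊓ 𝓟 A) (cocompact ℂ)) (hAB : MapsTo h A B) :
    MapsTo h (componentAtInfty A) (componentAtInfty B) := by
  have hsub := componentAtInfty_subset A
  refine mapsTo_iff_image_subset.2 (subset_componentAtInfty
    (isPreconnected_withInfty_image (hc.mono hsub) (ht.mono_left ?_)
      (isPreconnected_withInfty_componentAtInfty A)) ?_)
  · exact inf_le_inf_left _ (principal_mono.2 hsub)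
  · exact (hAB.mono_left hsub).image_subset

/-- Components of the finite part of a continuum through `∞` are unbounded. -/
theorem not_isBounded_connectedComponentIn {A : Set ℂ} (hA : IsClosed A)
    (hp : IsPreconnected (withInfty A)) {z : ℂ} (hz : z ∈ A) :
    ¬ Bornology.IsBounded (connectedComponentIn A z) := by
  intro hb
  obtain ⟨R, hR⟩ := hb.subset_ball 0
  have hzR : z ∈ Metric.ball (0 : ℂ) R := hR (mem_connectedComponentIn hz)
  -- Boundary bumping in a closed ball: the component of `z` in that part must leave the open ball,
  -- although the component of `z` in all of `A` was assumed to lie inside it.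
  obtain ⟨b, hb, hbO⟩ := exists_mem_connectedComponentIn_notMem (M := withInfty A)
    (E := (fun w : ℂ => (w : OnePoint ℂ)) '' Metric.closedBall 0 R)
    (O := (fun w : ℂ => (w : OnePoint ℂ)) '' Metric.ball 0 R) (a := (z : OnePoint ℂ))
    (isClosed_withInfty hA).isCompact hp
    ((isClosed_withInfty hA).inter (OnePoint.isClosed_image_coe.2
      ⟨Metric.isClosed_closedBall, isCompact_closedBall _ _⟩))
    ((isClosed_withInfty hA).sdiff (OnePoint.isOpen_image_coe.2 Metric.isOpen_ball))
    (inter_subset_right.trans (image_mono Metric.ball_subset_closedBall))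
    (fun h => by simpa using h (infty_mem_withInfty A))
    ⟨coe_mem_withInfty.2 hz, z, Metric.ball_subset_closedBall hzR, rfl⟩
  have hset : withInfty A ∩ (fun w : ℂ => (w : OnePoint ℂ)) '' Metric.closedBall 0 R =
      (fun w : ℂ => (w : OnePoint ℂ)) '' (A ∩ Metric.closedBall 0 R) := by
    ext u
    constructor
    · rintro ⟨hu, w, hw, rfl⟩
      exact ⟨w, ⟨coe_mem_withInfty.1 hu, hw⟩, rfl⟩
    · rintro ⟨w, ⟨hwA, hw⟩, rfl⟩
      exact ⟨coe_mem_withInfty.2 hwA, w, hw, rfl⟩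
  rw [hset] at hb
  have hzm : (z : OnePoint ℂ) ∈ (fun w : ℂ => (w : OnePoint ℂ)) '' (A ∩ Metric.closedBall 0 R) :=
    ⟨z, ⟨hz, Metric.ball_subset_closedBall hzR⟩, rfl⟩
  have hpre : IsPreconnected ((fun w : ℂ => (w : OnePoint ℂ)) ⁻¹' connectedComponentIn
      ((fun w : ℂ => (w : OnePoint ℂ)) '' (A ∩ Metric.closedBall 0 R)) z) :=
    isPreconnected_connectedComponentIn.preimage_of_isOpenMap OnePoint.coe_injective
      OnePoint.isOpenEmbedding_coe.isOpenMap
      ((connectedComponentIn_subset _ _).trans (image_subset_range _ _))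
  obtain ⟨w, hw, rfl⟩ := connectedComponentIn_subset _ _ hb
  have hsub := hpre.subset_connectedComponentIn (F := A) (x := z) (mem_connectedComponentIn hzm)
    (fun v hv => by
      obtain ⟨v', hv', hvv⟩ := connectedComponentIn_subset _ _ hv
      exact OnePoint.coe_injective hvv ▸ hv'.1)
  exact hbO ⟨w, hR (hsub hb), rfl⟩

/-- The unbounded component of `A` outside an initial part reaches any level that cuts `A`. -/
theorem exists_mem_componentAtInfty_notMem {A B O : Set ℂ} (hA : IsClosed A)
    (hp : IsPreconnected (withInfty A)) (hB : IsClosed B) (hO : IsOpen O) (hOB : O ⊆ B)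
    (hb : Bornology.IsBounded (A \ O)) (hne : ¬ A ⊆ B) :
    ∃ a ∈ componentAtInfty (A ∩ B), a ∉ O := by
  have hset : withInfty A ∩ withInfty B = withInfty (A ∩ B) := by
    ext u
    induction u using OnePoint.rec with
    | infty => simp [infty_mem_withInfty]
    | coe z => simp
  have hdiff : withInfty A \ withInfty O = (fun w : ℂ => (w : OnePoint ℂ)) '' (A \ O) := by
    ext u
    induction u using OnePoint.rec with
    | infty => simp [infty_mem_withInfty]
    | coe z => simp
  obtain ⟨b, hb, hbO⟩ := exists_mem_connectedComponentIn_notMem (M := withInfty A)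
    (E := withInfty B) (O := withInfty O) (a := OnePoint.infty)
    (isClosed_withInfty hA).isCompact hp
    ((isClosed_withInfty hA).inter (isClosed_withInfty hB))
    (by
      rw [hdiff, OnePoint.isClosed_image_coe]
      exact ⟨hA.sdiff hO, Metric.isCompact_of_isClosed_isBounded (hA.sdiff hO) hb⟩)
    (inter_subset_right.trans (withInfty_mono hOB))
    (fun h => hne fun z hz => coe_mem_withInfty.1 (h (coe_mem_withInfty.2 hz)))
    ⟨infty_mem_withInfty A, infty_mem_withInfty B⟩
  rw [hset] at hb
  induction b using OnePoint.rec with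
  | infty => exact absurd (infty_mem_withInfty O) hbO
  | coe z => exact ⟨z, hb, fun h => hbO (coe_mem_withInfty.2 h)⟩

end WithInfty

/-! ### Bloch's theorem and chains of holomorphic discs. -/

section HolomorphicMaps

/-- The inverse of an injective holomorphic map is holomorphic. -/
theorem differentiableOn_invFunOn {F : ℂ → ℂ} {T H : Set ℂ} (hT : IsOpen T)
    (hF : DifferentiableOn ℂ F T) (hb : BijOn F T H) :
    DifferentiableOn ℂ (Function.invFunOn F T) H := by
  set G := Function.invFunOn F T with hG
  have hinv : InvOn G F T H := hb.invOn_invFunOn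
  have hGm : MapsTo G H T := hb.surjOn.mapsTo_invFunOn
  have han : AnalyticOnNhd ℂ F T := hF.analyticOnNhd hT
  have hnc : ∀ z ∈ T, ∀ w, ¬ ∀ᶠ y in 𝓝 z, F y = w := by
    intro z hz w h
    have h1 : ∀ᶠ y in 𝓝 z, y = z := by
      filter_upwards [h, hT.mem_nhds hz] with y hy hyT
      exact hb.injOn hyT hz (hy.trans (h.self_of_nhds).symm)
    have h2 : ∀ᶠ y in 𝓝[≠] z, False := by
      filter_upwards [h1.filter_mono nhdsWithin_le_nhds, self_mem_nhdsWithin] with y hy hy'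
      exact hy' hy
    exact (NormedField.nhdsNE_neBot z).ne (Filter.eventually_false_iff_eq_bot.1 h2)
  have hopen : ∀ ζ ∈ H, 𝓝 ζ ≤ map F (𝓝 (G ζ)) := by
    intro ζ hζ
    have := (han _ (hGm hζ)).eventually_constant_or_nhds_le_map_nhds.resolve_left
      (hnc _ (hGm hζ) _)
    rwa [hinv.2 hζ] at this
  have hHo : IsOpen H := by
    rw [isOpen_iff_mem_nhds]
    intro ζ hζ
    have := hopen ζ hζ (image_mem_map (hT.mem_nhds (hGm hζ)))
    rwa [hb.image_eq] at this
  have hcont : ∀ ζ ∈ H, ContinuousAt G ζ := by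
    intro ζ hζ S hS
    have h1 := hopen ζ hζ (image_mem_map (inter_mem hS (hT.mem_nhds (hGm hζ))))
    refine mem_map.2 (mem_of_superset h1 ?_)
    rintro _ ⟨y, ⟨hyS, hyT⟩, rfl⟩
    rw [mem_preimage, hinv.1 hyT]
    exact hyS
  have hdiff : ∀ ζ ∈ H, deriv F (G ζ) ≠ 0 → DifferentiableAt ℂ G ζ := by
    intro ζ hζ hd
    refine (HasDerivAt.of_local_left_inverse (hcont ζ hζ)
      ((hF.differentiableAt (hT.mem_nhds (hGm hζ))).hasDerivAt) hd ?_).differentiableAt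
    filter_upwards [hHo.mem_nhds hζ] with y hy using hinv.2 hy
  intro ζ hζ
  refine DifferentiableAt.differentiableWithinAt ?_
  -- Zeros of the derivative are isolated, since otherwise `F` would be locally constant. At such a
  -- point the continuous inverse extends holomorphically by removability.
  have hpunct : ∀ᶠ z in 𝓝[≠] (G ζ), deriv F z ≠ 0 := by
    rcases (han _ (hGm hζ)).deriv.eventually_eq_zero_or_eventually_ne_zero with h | h
    · exfalso
      obtain ⟨ε, hε, hball⟩ := Metric.eventually_nhds_iff_ball.1
        (h.and (hT.mem_nhds (hGm hζ)))
      refine hnc _ (hGm hζ) (F (G ζ)) ?_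
      filter_upwards [Metric.ball_mem_nhds (G ζ) hε] with y hy
      exact Metric.isOpen_ball.is_const_of_deriv_eq_zero (convex_ball _ _).isPreconnected
        (hF.mono fun x hx => (hball x hx).2) (fun x hx => (hball x hx).1) hy
        (Metric.mem_ball_self hε)
    · exact h
  refine Complex.analyticAt_of_differentiable_on_punctured_nhds_of_continuousAt ?_
    (hcont ζ hζ) |>.differentiableAt
  have h1 : Tendsto G (𝓝[≠] ζ) (𝓝[≠] (G ζ)) := by
    refine tendsto_nhdsWithin_iff.2 ⟨(hcont ζ hζ).tendsto.mono_left nhdsWithin_le_nhds, ?_⟩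
    filter_upwards [self_mem_nhdsWithin, mem_nhdsWithin_of_mem_nhds (hHo.mem_nhds hζ)] with y hy hyH
    intro h
    exact hy (hinv.2.injOn hyH hζ h)
  filter_upwards [h1.eventually hpunct, mem_nhdsWithin_of_mem_nhds (hHo.mem_nhds hζ)] with y hy hyH
  exact hdiff y hyH hy

/-- A weak form of Bloch's theorem. -/
theorem norm_deriv_le_of_forall_ball_subset {f : ℂ → ℂ} {R L : ℝ} (hR : 0 < R)
    (hf : DifferentiableOn ℂ f (Metric.ball 0 R))
    (hL : ∀ c ρ, Metric.ball c ρ ⊆ f '' Metric.ball 0 R → ρ ≤ L) :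
    ‖deriv f 0‖ ≤ 96 * L / R := by
  have hL0 : 0 ≤ L := hL 0 0 (by simp)
  by_cases h0 : deriv f 0 = 0
  · rw [h0, norm_zero]; positivity
  have han : AnalyticOnNhd ℂ f (Metric.ball 0 R) := hf.analyticOnNhd Metric.isOpen_ball
  have hd' : DifferentiableOn ℂ (deriv f) (Metric.ball 0 R) := han.deriv.differentiableOn
  set r := R / 2 with hr
  have hr0 : 0 < r := by positivity
  have hsub : Metric.closedBall (0 : ℂ) r ⊆ Metric.ball 0 R :=
    Metric.closedBall_subset_ball (by linarith)
  -- Landau's choice of centre: maximality of (r - |z|)·|f'(z)| at `a` gives |f'| ≤ 2|f'(a)| on a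
  -- disc about `a` of half the remaining radius.
  obtain ⟨a, haB, hmax⟩ := (isCompact_closedBall (0 : ℂ) r).exists_isMaxOn
    ⟨0, Metric.mem_closedBall_self hr0.le⟩
    (f := fun z => (r - ‖z‖) * ‖deriv f z‖)
    ((continuousOn_const.sub continuous_norm.continuousOn).mul
      ((hd'.continuousOn.mono hsub).norm))
  have ha0 : r * ‖deriv f 0‖ ≤ (r - ‖a‖) * ‖deriv f a‖ := by
    simpa using hmax (Metric.mem_closedBall_self hr0.le)
  have har : ‖a‖ ≤ r := by simpa using haB
  set A := ‖deriv f a‖ with hA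
  have hpos : 0 < r * ‖deriv f 0‖ := mul_pos hr0 (norm_pos_iff.2 h0)
  have hAr : 0 < (r - ‖a‖) * A := hpos.trans_le ha0
  have hA0 : 0 < A := by
    rcases (norm_nonneg (deriv f a)).lt_or_eq with h | h
    · exact h
    · rw [hA, ← h, mul_zero] at hAr; exact absurd hAr (lt_irrefl _)
  have har' : 0 < r - ‖a‖ := pos_of_mul_pos_left hAr hA0.le
  set t := (r - ‖a‖) / 2 with ht
  have ht0 : 0 < t := by positivity
  have htsub : Metric.ball a t ⊆ Metric.closedBall 0 r := by
    intro z hz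
    have h1 : ‖z - a‖ < t := by simpa [dist_eq_norm] using hz
    have h2 : ‖z‖ ≤ ‖z - a‖ + ‖a‖ := by simpa using norm_add_le (z - a) a
    rw [mem_closedBall_zero_iff]; linarith
  have hder : ∀ z ∈ Metric.ball a t, ‖deriv f z‖ ≤ 2 * A := by
    intro z hz
    have h1 : ‖z - a‖ < t := by simpa [dist_eq_norm] using hz
    have h2 : ‖z‖ ≤ ‖z - a‖ + ‖a‖ := by simpa using norm_add_le (z - a) a
    have h3 : (r - ‖z‖) * ‖deriv f z‖ ≤ (r - ‖a‖) * A := hmax (htsub hz)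
    have h4 : t * ‖deriv f z‖ ≤ (r - ‖z‖) * ‖deriv f z‖ :=
      mul_le_mul_of_nonneg_right (by linarith) (norm_nonneg _)
    have h5 : t * ‖deriv f z‖ ≤ t * (2 * A) := by
      calc _ ≤ (r - ‖a‖) * A := h4.trans h3
        _ = t * (2 * A) := by rw [ht]; ring
    exact le_of_mul_le_mul_left h5 ht0
  have hschwarz : ∀ z ∈ Metric.ball a t, ‖deriv f z - deriv f a‖ ≤ 3 * A / t * ‖z - a‖ := by
    intro z hz
    have := Complex.dist_le_div_mul_dist_of_mapsTo_ball (f := deriv f) (R₂ := 3 * A)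
      (hd'.mono (htsub.trans hsub)) (fun w hw => ?_) hz
    · simpa [dist_eq_norm] using this
    · rw [Metric.mem_closedBall, dist_eq_norm]
      calc _ ≤ ‖deriv f w‖ + ‖deriv f a‖ := norm_sub_le _ _
        _ ≤ 3 * A := by linarith [hder w hw]
  -- At this radius the Schwarz bound (3A/t)|z - a| on the variation of f' is at most A/2. So |f(z)
  -- - f(a)| ≥ Aρ/2 on the circle, and the image contains a disc of radius Aρ/4 = A(r - |a|)/48.
  -- With r = R/2 this yields the constant 96.
  set ρ := t / 6 with hρ
  have hρ0 : 0 < ρ := by positivity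
  have hρt : Metric.closedBall a ρ ⊆ Metric.ball a t :=
    Metric.closedBall_subset_ball (by linarith)
  have hdf : ∀ z ∈ Metric.closedBall a ρ, DifferentiableAt ℂ f z := fun z hz =>
    hf.differentiableAt (Metric.isOpen_ball.mem_nhds (hsub (htsub (hρt hz))))
  have hmvt : ∀ z ∈ Metric.closedBall a ρ,
      ‖(f z - deriv f a * z) - (f a - deriv f a * a)‖ ≤ A / 2 * ‖z - a‖ := by
    intro z hz
    refine (convex_closedBall a ρ).norm_image_sub_le_of_norm_hasDerivWithin_le
      (f := fun z => f z - deriv f a * z) (f' := fun z => deriv f z - deriv f a)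
      (fun w hw => ?_) (fun w hw => ?_) (Metric.mem_closedBall_self hρ0.le) hz
    · have h1 := (hdf w hw).hasDerivAt.sub ((hasDerivAt_id w).const_mul (deriv f a))
      rw [mul_one] at h1
      exact h1.hasDerivWithinAt
    · have h1 : ‖w - a‖ ≤ ρ := by simpa [dist_eq_norm] using hw
      calc _ ≤ 3 * A / t * ‖w - a‖ := hschwarz w (hρt hw)
        _ ≤ 3 * A / t * ρ := by gcongr
        _ = A / 2 := by rw [hρ]; field_simp; norm_num
  have hdc : DiffContOnCl ℂ f (Metric.ball a ρ) := by
    refine DifferentiableOn.diffContOnCl ?_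
    rw [closure_ball a hρ0.ne']
    exact fun z hz => (hdf z hz).differentiableWithinAt
  have himg := hdc.ball_subset_image_closedBall hρ0 (ε := A * ρ / 2) (fun z hz => ?_) ?_
  · have h1 := hL _ _ (himg.trans (image_mono (hρt.trans (htsub.trans hsub))))
    rw [le_div_iff₀ hR]
    have h2 : A * ρ / 2 / 2 = (r - ‖a‖) * A / 48 := by rw [hρ, ht]; ring
    rw [h2] at h1
    have h3 : r * ‖deriv f 0‖ ≤ 48 * L := by linarith
    rw [hr] at h3
    linarith
  · have h1 := hmvt z (Metric.sphere_subset_closedBall hz)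
    have h2 : ‖z - a‖ = ρ := by simpa [dist_eq_norm] using hz
    have h3 : ‖deriv f a * (z - a)‖ = A * ρ := by rw [norm_mul, h2]
    have h4 : deriv f a * (z - a) =
      (f z - f a) - ((f z - deriv f a * z) - (f a - deriv f a * a)) := by ring
    have h5 := norm_sub_le (f z - f a) ((f z - deriv f a * z) - (f a - deriv f a * a))
    rw [← h4, h3] at h5
    rw [h2] at h1
    linarith
  · intro h
    have h1 : f =ᶠ[𝓝 a] fun _ => f a := by
      filter_upwards [h] with z hz using not_not.1 hz
    have h2 := h1.deriv_eq
    rw [deriv_const] at h2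
    rw [hA, h2, norm_zero] at hA0
    exact lt_irrefl _ hA0

/-- Two points of `U` joined by a holomorphic disc of radius `R` in `U`. -/
def JoinedByDisc (U : Set ℂ) (R : ℝ) (p q : ℂ) : Prop :=
  ∃ f : ℂ → ℂ, DifferentiableOn ℂ f (Metric.ball 0 R) ∧ MapsTo f (Metric.ball 0 R) U ∧
    f 0 = p ∧ f 1 = q

theorem joinedByDisc_of_ball_subset {U : Set ℂ} {p q : ℂ} {r : ℝ}
    (hU : Metric.ball p (2 * r) ⊆ U) (hq : ‖q - p‖ ≤ r) (hr : 0 < r) : JoinedByDisc U 2 p q := by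
  refine ⟨fun ζ => p + ζ * (q - p), by fun_prop, fun ζ hζ => hU ?_, by simp, by simp⟩
  rw [mem_ball_zero_iff] at hζ
  rw [mem_ball_iff_norm, add_sub_cancel_left, norm_mul]
  nlinarith [norm_nonneg ζ, norm_nonneg (q - p)]

theorem JoinedByDisc.comp {U V : Set ℂ} {R : ℝ} {p q : ℂ} (h : JoinedByDisc U R p q) {G : ℂ → ℂ}
    (hG : DifferentiableOn ℂ G U) (hm : MapsTo G U V) : JoinedByDisc V R (G p) (G q) := by
  obtain ⟨f, hf, hfm, rfl, rfl⟩ := h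
  exact ⟨G ∘ f, hG.comp hf hfm, hm.comp hfm, rfl, rfl⟩

theorem norm_deriv_le_of_mapsTo_ball {U : Set ℂ} {L : ℝ}
    (hL : ∀ c ρ, Metric.ball c ρ ⊆ U → ρ ≤ L) {g : ℂ → ℂ} {R : ℝ} {c : ℂ} (hR : 0 < R)
    (hg : DifferentiableOn ℂ g (Metric.ball c R)) (hm : MapsTo g (Metric.ball c R) U) :
    ‖deriv g c‖ ≤ 96 * L / R := by
  have hmap : MapsTo (fun z => c + z) (Metric.ball (0 : ℂ) R) (Metric.ball c R) := by
    intro z hz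
    rw [mem_ball_iff_norm, add_sub_cancel_left]
    exact mem_ball_zero_iff.1 hz
  have h1 := norm_deriv_le_of_forall_ball_subset (f := fun z => g (c + z)) (L := L) hR
    (hg.comp (by fun_prop) hmap)
    (fun d ρ hd => hL d ρ (hd.trans (image_subset_iff.2 fun z hz => hm (hmap hz))))
  rwa [deriv_comp_const_add, add_zero] at h1

/-- As R ≥ 2, a disc of radius R/2 about any point of the closed unit disc stays in the disc of
radius R; halving the radius turns 96 into 192. -/
theorem norm_sub_le_of_mapsTo_ball {U : Set ℂ} {L : ℝ}
    (hL : ∀ c ρ, Metric.ball c ρ ⊆ U → ρ ≤ L) {g : ℂ → ℂ} {R : ℝ} (hR : 2 ≤ R)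
    (hg : DifferentiableOn ℂ g (Metric.ball 0 R)) (hm : MapsTo g (Metric.ball 0 R) U)
    {x y : ℂ} (hx : ‖x‖ ≤ 1) (hy : ‖y‖ ≤ 1) : ‖g y - g x‖ ≤ 192 * L / R * ‖y - x‖ := by
  have hL0 : 0 ≤ L := hL 0 0 (by simp)
  refine (convex_closedBall (0 : ℂ) 1).norm_image_sub_le_of_norm_deriv_le (fun z hz => ?_)
    (fun z hz => ?_) (mem_closedBall_zero_iff.2 hx) (mem_closedBall_zero_iff.2 hy)
  · rw [mem_closedBall_zero_iff] at hz
    exact hg.differentiableAt (Metric.isOpen_ball.mem_nhds (mem_ball_zero_iff.2 (by linarith)))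
  · rw [mem_closedBall_zero_iff] at hz
    have hsub : Metric.ball z (R / 2) ⊆ Metric.ball 0 R := by
      intro w hw
      rw [mem_ball_iff_norm] at hw
      have h2 : ‖w‖ ≤ ‖w - z‖ + ‖z‖ := by simpa using norm_add_le (w - z) z
      rw [mem_ball_zero_iff]; linarith
    have := norm_deriv_le_of_mapsTo_ball hL (by linarith) (hg.mono hsub) (hm.mono_left hsub)
    calc _ ≤ 96 * L / (R / 2) := this
      _ = 192 * L / R := by field_simp; ring

theorem JoinedByDisc.norm_sub_le {U : Set ℂ} {L : ℝ}
    (hL : ∀ c ρ, Metric.ball c ρ ⊆ U → ρ ≤ L) {R : ℝ} (hR : 2 ≤ R) {p q : ℂ}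
    (h : JoinedByDisc U R p q) : ‖q - p‖ ≤ 192 * L / R := by
  obtain ⟨g, hg, hm, rfl, rfl⟩ := h
  simpa using norm_sub_le_of_mapsTo_ball hL hR hg hm (x := 0) (y := 1) (by simp) (by simp)

/-- Discs in `U` can be enlarged by a definite factor inside a neighbourhood `V` of `U`. -/
theorem JoinedByDisc.enlarge {U V : Set ℂ} {L ε l : ℝ}
    (hL : ∀ c ρ, Metric.ball c ρ ⊆ U → ρ ≤ L) (hUV : ∀ z ∈ U, Metric.ball z ε ⊆ V)
    (hl : 1 < l) (hlε : 192 * L * (l - 1) < ε) {R : ℝ} (hR : 2 ≤ R) {p q : ℂ}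
    (h : JoinedByDisc U R p q) : JoinedByDisc V (l * R) p q := by
  obtain ⟨g, hg, hm, rfl, rfl⟩ := h
  have hL0 : 0 ≤ L := hL 0 0 (by simp)
  have hl0 : 0 < l := by linarith
  have hlC : (l : ℂ) ≠ 0 := by exact_mod_cast hl0.ne'
  have hmap : MapsTo (fun ζ : ℂ => ζ / l) (Metric.ball 0 (l * R)) (Metric.ball 0 R) := by
    intro ζ hζ
    rw [mem_ball_zero_iff] at hζ ⊢
    rw [norm_div, Complex.norm_real, Real.norm_of_nonneg hl0.le, div_lt_iff₀ hl0]
    linarith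
  -- Dilating the disc by `l` keeps the value at 0 but spoils that at 1; the linear term restores
  -- it. By the Bloch estimate this term is smaller than ε, so the new disc stays in `V`.
  refine ⟨fun ζ => g (ζ / l) + ζ * (g 1 - g (1 / l)), ?_, ?_, by simp, by simp⟩
  · exact (hg.comp (by fun_prop) hmap).add (by fun_prop)
  · intro ζ hζ
    refine hUV _ (hm (hmap hζ)) ?_
    rw [mem_ball_iff_norm, add_sub_cancel_left, norm_mul]
    rw [mem_ball_zero_iff] at hζ
    have hn : ‖(1 / l : ℂ)‖ = 1 / l := by
      rw [norm_div, Complex.norm_real, Real.norm_of_nonneg hl0.le, norm_one]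
    have h1 := norm_sub_le_of_mapsTo_ball hL hR hg hm (x := 1 / l) (y := 1)
      (by rw [hn, div_le_one hl0]; exact hl.le) (by simp)
    have h2 : ‖(1 : ℂ) - 1 / l‖ = (l - 1) / l := by
      have : (1 : ℂ) - 1 / l = (((l - 1) / l : ℝ) : ℂ) := by
        push_cast; field_simp
      rw [this, Complex.norm_real, Real.norm_of_nonneg (div_nonneg (by linarith) hl0.le)]
    rw [h2] at h1
    calc ‖ζ‖ * ‖g 1 - g (1 / l)‖ ≤ (l * R) * (192 * L / R * ((l - 1) / l)) := by
          gcongr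
      _ = 192 * L * (l - 1) := by field_simp
      _ < ε := hlε

/-- The oscillation on a compact subset of a domain of a map is controlled by its oscillation
along holomorphic discs. -/
theorem exists_chain_bound {U Q : Set ℂ} (hU : IsOpen U) (hUc : IsPreconnected U)
    (hQ : IsCompact Q) (hQU : Q ⊆ U) :
    ∃ N : ℕ, ∀ p ∈ Q, ∀ q ∈ Q, ∀ (Γ : ℂ → ℂ) (δ : ℝ), 0 ≤ δ →
      (∀ x ∈ U, ∀ y ∈ U, JoinedByDisc U 2 x y → ‖Γ y - Γ x‖ ≤ δ) → ‖Γ q - Γ p‖ ≤ N * δ := by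
  rcases Q.eq_empty_or_nonempty with rfl | ⟨p₀, hp₀⟩
  · exact ⟨0, by simp⟩
  -- Points reached from `p₀` at cost `N`, for all maps Γ at once. The points of finite cost form a
  -- relatively clopen subset of `U`, and compactness of `Q` makes the cost uniform.
  let S : ℕ → Set ℂ := fun N => {q | ∀ (Γ : ℂ → ℂ) (δ : ℝ), 0 ≤ δ →
    (∀ x ∈ U, ∀ y ∈ U, JoinedByDisc U 2 x y → ‖Γ y - Γ x‖ ≤ δ) → ‖Γ q - Γ p₀‖ ≤ N * δ}
  have hSm : ∀ {m n : ℕ}, m ≤ n → S m ⊆ S n := by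
    intro m n hmn q hq Γ δ hδ h
    refine (hq Γ δ hδ h).trans ?_
    gcongr
  have hstep : ∀ {N x y}, x ∈ U → y ∈ U → x ∈ S N →
      (JoinedByDisc U 2 x y ∨ JoinedByDisc U 2 y x) → y ∈ S (N + 1) := by
    intro N x y hx hy hxS hxy Γ δ hδ h
    have h1 := hxS Γ δ hδ h
    have h2 : ‖Γ y - Γ x‖ ≤ δ := by
      rcases hxy with hxy | hxy
      · exact h x hx y hy hxy
      · rw [norm_sub_rev]; exact h y hy x hx hxy
    have h3 := norm_add_le (Γ y - Γ x) (Γ x - Γ p₀)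
    rw [sub_add_sub_cancel] at h3
    push_cast
    linarith
  have hrad : ∀ x ∈ U, ∃ r > 0, Metric.ball x r ⊆ U ∧ ∀ y ∈ Metric.ball x r,
      JoinedByDisc U 2 x y := by
    intro x hx
    obtain ⟨r, hr, hball⟩ := Metric.isOpen_iff.1 hU x hx
    refine ⟨r / 2, by positivity, (Metric.ball_subset_ball (by linarith)).trans hball, ?_⟩
    intro y hy
    refine joinedByDisc_of_ball_subset (r := r / 2) ?_ (mem_ball_iff_norm.1 hy).le (by positivity)
    rwa [mul_div_cancel₀ r two_ne_zero]
  have hall : U ⊆ {x | x ∈ U ∧ ∃ N, x ∈ S N} := by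
    refine hUc.subset_left_of_subset_union (v := {x | x ∈ U ∧ ¬ ∃ N, x ∈ S N}) ?_ ?_ ?_ ?_ ?_
    · rw [Metric.isOpen_iff]
      rintro x ⟨hx, N, hxN⟩
      obtain ⟨r, hr, hrU, hj⟩ := hrad x hx
      exact ⟨r, hr, fun y hy => ⟨hrU hy, N + 1, hstep hx (hrU hy) hxN (Or.inl (hj y hy))⟩⟩
    · rw [Metric.isOpen_iff]
      rintro x ⟨hx, hxN⟩
      obtain ⟨r, hr, hrU, hj⟩ := hrad x hx
      refine ⟨r, hr, fun y hy => ⟨hrU hy, fun ⟨N, hyN⟩ => hxN ⟨N + 1, ?_⟩⟩⟩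
      exact hstep (hrU hy) hx hyN (Or.inr (hj y hy))
    · rw [Set.disjoint_left]
      exact fun x hx hx' => hx'.2 hx.2
    · intro x hx
      by_cases h : ∃ N, x ∈ S N
      · exact Or.inl ⟨hx, h⟩
      · exact Or.inr ⟨hx, h⟩
    · exact ⟨p₀, hQU hp₀, hQU hp₀, 0, fun Γ δ _ _ => by simp⟩
  obtain ⟨N, hN⟩ : ∃ N, Q ⊆ S N := by
    refine hQ.induction_on (p := fun s => ∃ N, s ⊆ S N) ⟨0, empty_subset _⟩
      (fun s t hst ⟨N, hN⟩ => ⟨N, hst.trans hN⟩) ?_ ?_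
    · rintro s t ⟨m, hm⟩ ⟨n, hn⟩
      exact ⟨max m n, union_subset (hm.trans (hSm (le_max_left _ _)))
        (hn.trans (hSm (le_max_right _ _)))⟩
    · intro x hx
      obtain ⟨-, N, hxN⟩ := hall (hQU hx)
      obtain ⟨r, hr, hrU, hj⟩ := hrad x (hQU hx)
      exact ⟨Metric.ball x r, mem_nhdsWithin_of_mem_nhds (Metric.ball_mem_nhds x hr), N + 1,
        fun y hy => hstep (hQU hx) (hrU hy) hxN (Or.inl (hj y hy))⟩
  refine ⟨N + N, fun p hp q hq Γ δ hδ h => ?_⟩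
  have h1 := hN hp Γ δ hδ h
  have h2 := hN hq Γ δ hδ h
  have h3 := norm_sub_le (Γ q - Γ p₀) (Γ p - Γ p₀)
  rw [sub_sub_sub_cancel_right] at h3
  push_cast
  linarith

end HolomorphicMaps

/-! ### Translation by multiples of 2πi. -/

section Periods

/-- The period `2πik`. -/
noncomputable def period (k : ℤ) : ℂ := k * (2 * Real.pi * Complex.I)

theorem period_add (j k : ℤ) : period (j + k) = period j + period k := by
  simp only [period]; push_cast; ring

theorem period_neg (k : ℤ) : period (-k) = -period k := by
  simp only [period]; push_cast; ring

theorem period_zero : period 0 = 0 := by simp [period]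

theorem period_one : period 1 = 2 * Real.pi * Complex.I := by simp [period]

theorem period_re (k : ℤ) : (period k).re = 0 := by simp [period]

theorem period_im (k : ℤ) : (period k).im = k * (2 * Real.pi) := by simp [period]

theorem exp_add_period (z : ℂ) (k : ℤ) : Complex.exp (z + period k) = Complex.exp z :=
  Complex.exp_eq_exp_iff_exists_int.2 ⟨k, rfl⟩

theorem IsTwoPiIPeriodic.add_period_mem_iff {A : Set ℂ} (hA : IsTwoPiIPeriodic A) (k : ℤ) (z : ℂ) :
    z + period k ∈ A ↔ z ∈ A := by
  induction k using Int.induction_on with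
  | zero => rw [period_zero, add_zero]
  | succ n ih => rw [period_add, ← add_assoc, period_one, hA, ih]
  | pred n ih =>
    rw [← ih, ← hA (z + period (-↑n - 1)), sub_eq_add_neg, period_add, period_neg 1, period_one,
      ← add_assoc, neg_add_cancel_right]

theorem IsTwoPiIPeriodic.image_add_period {A : Set ℂ} (hA : IsTwoPiIPeriodic A) (k : ℤ) :
    Homeomorph.addRight (period k) '' A = A := by
  ext z
  constructor
  · rintro ⟨w, hw, rfl⟩
    exact (hA.add_period_mem_iff k w).2 hw
  · intro hz
    refine ⟨z + period (-k), (hA.add_period_mem_iff _ _).2 hz, ?_⟩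
    simp [period_neg]

theorem IsTwoPiIPeriodic.closure {A : Set ℂ} (hA : IsTwoPiIPeriodic A) :
    IsTwoPiIPeriodic (closure A) := by
  intro z
  have h1 := (Homeomorph.addRight (period 1)).image_closure A
  rw [hA.image_add_period 1] at h1
  rw [← period_one]
  constructor
  · intro hz
    rw [← h1] at hz
    obtain ⟨w, hw, hwz⟩ := hz
    exact (Homeomorph.addRight (period 1)).injective hwz ▸ hw
  · intro hz
    rw [← h1]
    exact ⟨z, hz, rfl⟩

/-- A translate has imaginary part in [0, 2π), and 7 exceeds 2π. -/
theorem exists_norm_sub_period_le (z : ℂ) : ∃ k : ℤ, ‖z - period k‖ ≤ |z.re| + 7 := by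
  have hpi := Real.pi_pos
  refine ⟨⌊z.im / (2 * Real.pi)⌋, (Complex.norm_le_abs_re_add_abs_im _).trans ?_⟩
  rw [Complex.sub_re, period_re, sub_zero, Complex.sub_im, period_im]
  have h1 := Int.floor_le (z.im / (2 * Real.pi))
  have h2 := Int.lt_floor_add_one (z.im / (2 * Real.pi))
  have h3 : z.im = z.im / (2 * Real.pi) * (2 * Real.pi) := by field_simp
  have h4 : |z.im - ⌊z.im / (2 * Real.pi)⌋ * (2 * Real.pi)| ≤ 7 := by
    rw [abs_le]
    have := Real.pi_lt_d2
    constructor <;> nlinarith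
  linarith

end Periods

/-! ### Geometry of tracts and inverse branches. -/

namespace IsBLog

variable {F : ℂ → ℂ} {𝒯 H : Set ℂ}

theorem isOpen_tract (hF : IsBLog F 𝒯 H) {T : Set ℂ} (hT : T ∈ tracts 𝒯) : IsOpen T :=
  (hF.jordan_tract T hT).1

theorem isPreconnected_tract (hF : IsBLog F 𝒯 H) {T : Set ℂ} (hT : T ∈ tracts 𝒯) :
    IsPreconnected T :=
  (hF.jordan_tract T hT).2.1.isPreconnected

theorem sUnion_tracts (𝒯 : Set ℂ) : ⋃₀ tracts 𝒯 = 𝒯 := by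
  ext z
  constructor
  · rintro ⟨_, ⟨w, -, rfl⟩, hz⟩
    exact connectedComponentIn_subset _ _ hz
  · exact fun hz => ⟨_, ⟨z, hz, rfl⟩, mem_connectedComponentIn hz⟩

theorem eq_of_mem_closure (hF : IsBLog F 𝒯 H) {T T' : Set ℂ} (hT : T ∈ tracts 𝒯)
    (hT' : T' ∈ tracts 𝒯) {z : ℂ} (hz : z ∈ closure T) (hz' : z ∈ closure T') : T = T' := by
  by_contra h
  exact Set.disjoint_left.1 (hF.disjoint_closure T hT T' hT' h) hz hz'

/-- Near `z` only finitely many tracts occur, so closure commutes with the union. -/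
theorem exists_mem_closure (hF : IsBLog F 𝒯 H) {S : Set (Set ℂ)} (hS : S ⊆ tracts 𝒯) {z : ℂ}
    (hz : z ∈ closure (⋃₀ S)) : ∃ T ∈ S, z ∈ closure T := by
  set B := Metric.ball (0 : ℂ) (‖z‖ + 1) with hB
  have hzB : z ∈ B := by simp [hB]
  have hfin : {T ∈ S | (T ∩ B).Nonempty}.Finite :=
    (hF.locally_finite (‖z‖ + 1)).subset fun T hT => ⟨hS hT.1, hT.2⟩
  have h1 : z ∈ closure (⋃ T ∈ {T ∈ S | (T ∩ B).Nonempty}, T) := by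
    rw [mem_closure_iff] at hz ⊢
    intro O hO hzO
    obtain ⟨w, ⟨hwO, hwB⟩, T, hT, hwT⟩ := hz (O ∩ B) (hO.inter Metric.isOpen_ball) ⟨hzO, hzB⟩
    exact ⟨w, hwO, mem_biUnion (show T ∈ {T ∈ S | (T ∩ B).Nonempty} from ⟨hT, w, hwT, hwB⟩) hwT⟩
  rw [hfin.closure_biUnion] at h1
  obtain ⟨T, hT, hzT⟩ := mem_iUnion₂.1 h1
  exact ⟨T, hT.1, hzT⟩

theorem exists_tract_of_mem_closure (hF : IsBLog F 𝒯 H) {z : ℂ} (hz : z ∈ closure 𝒯) :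
    ∃ T ∈ tracts 𝒯, z ∈ closure T :=
  hF.exists_mem_closure subset_rfl (by rwa [sUnion_tracts])

theorem closure_tract_subset {T : Set ℂ} (hT : T ∈ tracts 𝒯) : closure T ⊆ closure 𝒯 := by
  obtain ⟨z, -, rfl⟩ := hT
  exact closure_mono (connectedComponentIn_subset _ _)

/-- The closure of one tract and the closure of the union of all others are disjoint closed sets
covering the closure of 𝒯. This is why connected sets have constant addresses. -/
theorem subset_closure_tract (hF : IsBLog F 𝒯 H) {S T : Set ℂ} (hS : IsPreconnected S)
    (hS𝒯 : S ⊆ closure 𝒯) (hT : T ∈ tracts 𝒯) {z : ℂ} (hzS : z ∈ S) (hzT : z ∈ closure T) :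
    S ⊆ closure T := by
  intro w hw
  by_contra hwT
  have hcov : S ⊆ closure T ∪ closure (⋃₀ (tracts 𝒯 \ {T})) := by
    intro u hu
    obtain ⟨T', hT', hu'⟩ := hF.exists_tract_of_mem_closure (hS𝒯 hu)
    by_cases h : T' = T
    · exact Or.inl (h ▸ hu')
    · exact Or.inr (closure_mono (subset_sUnion_of_mem
        (show T' ∈ tracts 𝒯 \ {T} from ⟨hT', h⟩)) hu')
  obtain ⟨u, -, hu1, hu2⟩ := (isPreconnected_closed_iff.1 hS) _ _ isClosed_closure isClosed_closure
    hcov ⟨z, hzS, hzT⟩ ⟨w, hw, (hcov hw).resolve_left hwT⟩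
  obtain ⟨T', hT', hu'⟩ := hF.exists_mem_closure sdiff_subset hu2
  exact hT'.2 (hF.eq_of_mem_closure hT'.1 hT hu' hu1)

theorem translate_mem_tracts (hF : IsBLog F 𝒯 H) {T : Set ℂ} (hT : T ∈ tracts 𝒯) (k : ℤ) :
    Homeomorph.addRight (period k) '' T ∈ tracts 𝒯 := by
  obtain ⟨z, hz, rfl⟩ := hT
  refine ⟨z + period k, (hF.periodic_domain.add_period_mem_iff k z).2 hz, ?_⟩
  rw [Homeomorph.image_connectedComponentIn _ hz, hF.periodic_domain.image_add_period]
  rfl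

theorem translate_injective (hF : IsBLog F 𝒯 H) {T : Set ℂ} (hT : T ∈ tracts 𝒯) :
    Function.Injective fun k : ℤ => Homeomorph.addRight (period k) '' T := by
  intro j k hjk
  obtain ⟨z, hz⟩ := (hF.jordan_tract T hT).2.1.nonempty
  have h1 : z + period j ∈ Homeomorph.addRight (period k) '' T := by
    have hjk' : Homeomorph.addRight (period j) '' T = Homeomorph.addRight (period k) '' T := hjk
    rw [← hjk']
    exact ⟨z, hz, rfl⟩
  obtain ⟨w, hw, hwz⟩ := h1
  have hwz' : w + period k = z + period j := hwz
  have h2 : w = z := hF.exp_injective T hT hw hz (by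
    rw [← exp_add_period w k, hwz', exp_add_period])
  rw [h2] at hwz'
  have h3 := congrArg Complex.im (add_left_cancel hwz')
  rw [period_im, period_im] at h3
  have h4 := mul_right_cancel₀ (by positivity) h3
  exact_mod_cast h4.symm

/-- Only a bounded part of a tract lies in a left half-plane. -/
theorem isBounded_tract_inter (hF : IsBLog F 𝒯 H) {T : Set ℂ} (hT : T ∈ tracts 𝒯) (x : ℝ) :
    Bornology.IsBounded (T ∩ {z | z.re ≤ x}) := by
  obtain ⟨c, hc⟩ := hF.re_bddBelow T hT
  set r := |c| + |x| + 7 with hr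
  set S : Set ℤ := {k | ∃ z ∈ T, ‖z - period k‖ ≤ r} with hS
  -- Each `k` in `S` yields a translate of `T` meeting a fixed disc about 0. Distinct `k` give
  -- distinct tracts, so local finiteness applies.
  have hfin : S.Finite := by
    refine Set.Finite.of_finite_image (f := fun k : ℤ => Homeomorph.addRight (period (-k)) '' T)
      ((hF.locally_finite (r + 1)).subset ?_) ?_
    · rintro _ ⟨k, ⟨z, hz, hzk⟩, rfl⟩
      refine ⟨hF.translate_mem_tracts hT _, z - period k, ⟨z, hz, ?_⟩, ?_⟩
      · simp [period_neg, sub_eq_add_neg]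
      · rw [mem_ball_zero_iff]; linarith
    · exact ((hF.translate_injective hT).comp neg_injective).injOn
  refine ((Bornology.isBounded_biUnion hfin).2 fun k _ =>
    (Metric.isBounded_closedBall (x := period k) (r := r))).subset ?_
  rintro z ⟨hz, hzx⟩
  obtain ⟨k, hk⟩ := exists_norm_sub_period_le z
  have hcz : c ≤ z.re := hc ⟨z, hz, rfl⟩
  have hre : |z.re| ≤ |c| + |x| := by
    have hzx' : z.re ≤ x := hzx
    rw [abs_le]
    constructor
    · have := neg_abs_le c; have := abs_nonneg x; linarith
    · have := le_abs_self x; have := abs_nonneg c; linarith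
  have hkr : ‖z - period k‖ ≤ r := by rw [hr]; linarith
  exact mem_biUnion (show k ∈ S from ⟨z, hz, hkr⟩) (mem_closedBall_iff_norm.2 hkr)

/-- The bound is uniform over all tracts: modulo translation, a tract meeting the left half-plane
crosses its boundary line near the real axis, and only finitely many tracts do so. -/
theorem exists_norm_sub_period_le_of_re_le (hF : IsBLog F 𝒯 H) (x : ℝ) :
    ∃ D : ℝ, ∀ T ∈ tracts 𝒯, ∃ k : ℤ, ∀ z ∈ closure T, z.re ≤ x → ‖z - period k‖ ≤ D := by
  -- The extra unit leaves room to pass from `T` to its closure, using the open half-plane Re z < y.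
  set y := x + 1 with hy
  set r := |y| + 8 with hr
  have hfin := hF.locally_finite r
  have hB := (Bornology.isBounded_biUnion hfin (f := fun T : Set ℂ => T ∩ {z | z.re ≤ y})).2
    fun T hT => hF.isBounded_tract_inter hT.1 y
  obtain ⟨D, hD⟩ := hB.subset_closedBall 0
  refine ⟨D, fun T hT => ?_⟩
  suffices h : ∃ k : ℤ, T ∩ {z | z.re < y} ⊆ Metric.closedBall (period k) D by
    obtain ⟨k, hk⟩ := h
    refine ⟨k, fun z hz hzx => ?_⟩
    rw [← mem_closedBall_iff_norm]
    have hopen : IsOpen {z : ℂ | z.re < y} := isOpen_lt Complex.continuous_re continuous_const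
    refine closure_minimal hk Metric.isClosed_closedBall ?_
    rw [inter_comm]
    exact hopen.inter_closure ⟨show z.re < y by linarith, hz⟩
  by_cases hne : ∃ z ∈ T, z.re ≤ y
  · obtain ⟨z₁, hz₁, hz₁y⟩ := hne
    obtain ⟨z₂, hz₂, hz₂y⟩ : ∃ z ∈ T, y ≤ z.re := by
      by_contra! h
      exact hF.re_not_bddAbove T hT ⟨y, by rintro _ ⟨z, hz, rfl⟩; exact (h z hz).le⟩
    obtain ⟨z, hz, hzy⟩ := (hF.isPreconnected_tract hT).intermediate_value hz₁ hz₂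
      Complex.continuous_re.continuousOn ⟨hz₁y, hz₂y⟩
    obtain ⟨k, hk⟩ := exists_norm_sub_period_le z
    refine ⟨k, fun w hw => ?_⟩
    have hmem : w - period k ∈ Metric.closedBall (0 : ℂ) D := by
      refine hD (mem_biUnion (x := Homeomorph.addRight (period (-k)) '' T) ?_ ?_)
      · refine ⟨hF.translate_mem_tracts hT _, z - period k, ⟨z, hz, ?_⟩, ?_⟩
        · simp [period_neg, sub_eq_add_neg]
        · rw [mem_ball_zero_iff, hr, ← hzy]; linarith
      · refine ⟨⟨w, hw.1, by simp [period_neg, sub_eq_add_neg]⟩, ?_⟩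
        have : w.re < y := hw.2
        simp only [mem_ofPred_eq, Complex.sub_re, period_re]; linarith
    rw [mem_closedBall_iff_norm]
    exact mem_closedBall_zero_iff.1 hmem
  · push Not at hne
    exact ⟨0, fun z hz => absurd (hne z hz.1) (not_lt.2 (le_of_lt hz.2))⟩

theorem isBounded_closure_tract_inter (hF : IsBLog F 𝒯 H) {T : Set ℂ} (hT : T ∈ tracts 𝒯) (x : ℝ) :
    Bornology.IsBounded (closure T ∩ {z | z.re ≤ x}) := by
  obtain ⟨D, hD⟩ := hF.exists_norm_sub_period_le_of_re_le x
  obtain ⟨k, hk⟩ := hD T hT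
  exact Metric.isBounded_closedBall.subset fun z hz => mem_closedBall_iff_norm.2 (hk z hz.1 hz.2)

theorem isPreconnected_withInfty_closure_tract (hF : IsBLog F 𝒯 H) {T : Set ℂ}
    (hT : T ∈ tracts 𝒯) : IsPreconnected (withInfty (closure T)) := by
  refine isPreconnected_withInfty (hF.isPreconnected_tract hT).closure fun hb => ?_
  refine hF.re_not_bddAbove T hT ?_
  obtain ⟨R, hR⟩ := hb.subset_closedBall 0
  refine ⟨R, ?_⟩
  rintro _ ⟨z, hz, rfl⟩
  exact (Complex.re_le_norm z).trans (mem_closedBall_zero_iff.1 (hR (subset_closure hz)))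

/-- Tracts contain no large discs. -/
theorem radius_le_of_ball_subset_tract (hF : IsBLog F 𝒯 H) {T : Set ℂ} (hT : T ∈ tracts 𝒯)
    (c : ℂ) (ρ : ℝ) (h : Metric.ball c ρ ⊆ T) : ρ ≤ 7 := by
  by_contra! hρ
  have hp : ‖period 1‖ < 7 := by
    rw [period_one, norm_mul, Complex.norm_I, mul_one, norm_mul, Complex.norm_real,
      Real.norm_of_nonneg Real.pi_pos.le, Complex.norm_two]
    linarith [Real.pi_lt_d2]
  have h1 : c ∈ T := h (Metric.mem_ball_self (by linarith))
  have h2 : c + period 1 ∈ T := h (by rw [mem_ball_iff_norm, add_sub_cancel_left]; linarith)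
  have h3 := hF.exp_injective T hT h2 h1 (exp_add_period c 1)
  have h4 : (period 1).im = 0 := by rw [add_eq_left.1 h3]; simp
  rw [period_im] at h4
  have := Real.pi_pos
  simp at h4

/-- The inverse branch `H → T` of `F`. -/
theorem differentiableOn_inverse (hF : IsBLog F 𝒯 H) {T : Set ℂ} (hT : T ∈ tracts 𝒯) :
    DifferentiableOn ℂ (Function.invFunOn F T) H :=
  differentiableOn_invFunOn (hF.isOpen_tract hT) (hF.holomorphic T hT) (hF.bijective T hT)

theorem inverse_mem (hF : IsBLog F 𝒯 H) {T : Set ℂ} (hT : T ∈ tracts 𝒯) {ζ : ℂ} (hζ : ζ ∈ H) :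
    Function.invFunOn F T ζ ∈ T :=
  (hF.bijective T hT).surjOn.mapsTo_invFunOn hζ

theorem apply_inverse (hF : IsBLog F 𝒯 H) {T : Set ℂ} (hT : T ∈ tracts 𝒯) {ζ : ℂ} (hζ : ζ ∈ H) :
    F (Function.invFunOn F T ζ) = ζ :=
  (hF.bijective T hT).invOn_invFunOn.2 hζ

theorem continuousOn_closure_tract (hF : IsBLog F 𝒯 H) {T : Set ℂ} (hT : T ∈ tracts 𝒯) :
    ContinuousOn F (closure T) :=
  hF.continuous_closure.mono (closure_tract_subset hT)

/-- A point of the closure of a tract that is mapped into `H` is recovered by the inverse branch. -/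
theorem inverse_apply (hF : IsBLog F 𝒯 H) {T : Set ℂ} (hT : T ∈ tracts 𝒯) {z : ℂ}
    (hz : z ∈ closure T) (hFz : F z ∈ H) : Function.invFunOn F T (F z) = z := by
  have := mem_closure_iff_nhdsWithin_neBot.1 hz
  have h1 : Tendsto F (𝓝[T] z) (𝓝 (F z)) :=
    (hF.continuousOn_closure_tract hT z hz).mono_left (nhdsWithin_mono _ subset_closure)
  have h2 : Tendsto (Function.invFunOn F T) (𝓝 (F z)) (𝓝 (Function.invFunOn F T (F z))) :=
    ((hF.differentiableOn_inverse hT).differentiableAt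
      (hF.jordan_range.1.mem_nhds hFz)).continuousAt
  refine tendsto_nhds_unique (h2.comp h1) (Tendsto.congr' ?_
    (tendsto_id.mono_left nhdsWithin_le_nhds))
  filter_upwards [self_mem_nhdsWithin] with y hy
  exact ((hF.bijective T hT).invOn_invFunOn.1 hy).symm

/-- The inverse branches fix `∞`. -/
theorem tendsto_inverse (hF : IsBLog F 𝒯 H) {T : Set ℂ} (hT : T ∈ tracts 𝒯) :
    Tendsto (Function.invFunOn F T) (cocompact ℂ ⊓ 𝓟 H) (cocompact ℂ) := by
  intro S hS
  obtain ⟨C, hC, hCS⟩ := mem_cocompact.1 hS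
  rw [mem_map, mem_inf_principal, mem_cocompact]
  refine ⟨F '' (closure T ∩ C), ((hC.inter_left isClosed_closure).image_of_continuousOn
    ((hF.continuousOn_closure_tract hT).mono inter_subset_left)), ?_⟩
  intro ζ hζ hζH
  refine hCS fun hmem => hζ ⟨_, ⟨subset_closure (hF.inverse_mem hT hζH), hmem⟩,
    hF.apply_inverse hT hζH⟩

/-- On the part of a tract that is mapped into a closed subset of `H`, the map fixes `∞`. -/
theorem tendsto_of_mapsTo (hF : IsBLog F 𝒯 H) {T D : Set ℂ} (hT : T ∈ tracts 𝒯) (hD : IsClosed D)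
    (hDH : D ⊆ H) : Tendsto F (cocompact ℂ ⊓ 𝓟 {z ∈ closure T | F z ∈ D}) (cocompact ℂ) := by
  intro S hS
  obtain ⟨C, hC, hCS⟩ := mem_cocompact.1 hS
  rw [mem_map, mem_inf_principal, mem_cocompact]
  refine ⟨Function.invFunOn F T '' (D ∩ C), ((hC.inter_left hD).image_of_continuousOn
    ((hF.differentiableOn_inverse hT).continuousOn.mono (inter_subset_left.trans hDH))), ?_⟩
  rintro z hz ⟨hzT, hzD⟩
  exact hCS fun hmem => hz ⟨F z, ⟨hzD, hmem⟩, hF.inverse_apply hT hzT (hDH hzD)⟩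

end IsBLog

/-! ### Orbits with prescribed address. -/

section Itineraries

variable {F : ℂ → ℂ} {𝒯 H : Set ℂ}

/-- The two claims need a joint induction because `F` is continuous only on the closure of 𝒯:
continuity of an iterate on one itinerary set makes the next such set closed, and there the next
iterate is continuous. -/
theorem isClosed_itinerary_and_continuousOn (hF : ContinuousOn F (closure 𝒯)) {E : ℕ → Set ℂ}
    (hE : ∀ n, IsClosed (E n)) (hE𝒯 : ∀ n, E n ⊆ closure 𝒯) (n : ℕ) :
    IsClosed {z | ∀ j ≤ n, F^[j] z ∈ E j} ∧ ContinuousOn F^[n + 1] {z | ∀ j ≤ n, F^[j] z ∈ E j} := by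
  have hcomp : ∀ n, ContinuousOn F^[n] {z | ∀ j ≤ n, F^[j] z ∈ E j} →
      ContinuousOn F^[n + 1] {z | ∀ j ≤ n, F^[j] z ∈ E j} := by
    intro n h
    rw [Function.iterate_succ']
    exact hF.comp h fun z hz => hE𝒯 n (hz n le_rfl)
  induction n with
  | zero =>
    refine ⟨?_, hcomp 0 continuousOn_id⟩
    convert hE 0 using 1
    ext z; simp
  | succ n ih =>
    have h1 : {z | ∀ j ≤ n + 1, F^[j] z ∈ E j} =
        {z | ∀ j ≤ n, F^[j] z ∈ E j} ∩ F^[n + 1] ⁻¹' E (n + 1) := by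
      ext z
      simp only [mem_ofPred_eq, mem_inter_iff, mem_preimage, Nat.le_succ_iff, or_imp,
        forall_and, forall_eq]
    rw [h1]
    refine ⟨ih.2.preimage_isClosed_of_isClosed ih.1 (hE _), ?_⟩
    rw [← h1]
    refine hcomp (n + 1) (ih.2.mono ?_)
    rw [h1]
    exact inter_subset_left

/-- The points of the Julia set whose forward orbit stays in `D`. -/
def controlledSet (F : ℂ → ℂ) (𝒯 D : Set ℂ) : Set ℂ :=
  {z ∈ juliaSet F 𝒯 | ∀ n, 1 ≤ n → F^[n] z ∈ D}

/-- The closed sets through which the orbits with address `s` that stay in `D` have to pass. -/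
def addressLevel (D : Set ℂ) (s : ℕ → Set ℂ) (n : ℕ) : Set ℂ :=
  {z ∈ closure (s n) | 1 ≤ n → z ∈ D}

/-- The points with external address `s` whose forward orbit stays in `D`. -/
def controlledSetAt (F : ℂ → ℂ) (D : Set ℂ) (s : ℕ → Set ℂ) : Set ℂ :=
  {z | ∀ n, F^[n] z ∈ addressLevel D s n}

theorem isClosed_addressLevel {D : Set ℂ} (hD : IsClosed D) (s : ℕ → Set ℂ) (n : ℕ) :
    IsClosed (addressLevel D s n) := by
  by_cases hn : 1 ≤ n
  · convert (isClosed_closure (s := s n)).inter hD using 1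
    ext z; simp [addressLevel, hn]
  · convert (isClosed_closure (s := s n)) using 1
    ext z; simp [addressLevel, hn]

theorem addressLevel_subset {D : Set ℂ} {s : ℕ → Set ℂ} (hs : IsExternalAddress 𝒯 s) (n : ℕ) :
    addressLevel D s n ⊆ closure 𝒯 := fun _ hz => IsBLog.closure_tract_subset (hs n) hz.1

theorem controlledSetAt_eq_iInter (F : ℂ → ℂ) (D : Set ℂ) (s : ℕ → Set ℂ) :
    controlledSetAt F D s = ⋂ n, {z | ∀ j ≤ n, F^[j] z ∈ addressLevel D s j} := by
  ext z
  simp only [mem_iInter]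
  exact ⟨fun h n j _ => h j, fun h n => h n n le_rfl⟩

theorem controlledSetAt_subset_juliaSetAt {D : Set ℂ} {s : ℕ → Set ℂ}
    (hs : IsExternalAddress 𝒯 s) : controlledSetAt F D s ⊆ juliaSetAt F 𝒯 s := fun _ hz =>
  ⟨fun n => IsBLog.closure_tract_subset (hs n) (hz n).1, fun n => (hz n).1⟩

theorem controlledSetAt_subset {D : Set ℂ} {s : ℕ → Set ℂ} (hs : IsExternalAddress 𝒯 s) :
    controlledSetAt F D s ⊆ controlledSet F 𝒯 D := fun _ hz =>
  ⟨(controlledSetAt_subset_juliaSetAt hs hz).1, fun n hn => (hz n).2 hn⟩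

theorem mapsTo_controlledSetAt {D : Set ℂ} {s : ℕ → Set ℂ} :
    MapsTo F (controlledSetAt F D s) (controlledSetAt F D fun n => s (n + 1)) := by
  intro z hz n
  rw [← Function.iterate_succ_apply]
  exact ⟨(hz (n + 1)).1, fun _ => (hz (n + 1)).2 (by omega)⟩

theorem IsExternalAddress.shift {s : ℕ → Set ℂ} (hs : IsExternalAddress 𝒯 s) (k : ℕ) :
    IsExternalAddress 𝒯 fun n => s (n + k) := fun n => hs (n + k)

namespace IsBLog

theorem exists_address (hF : IsBLog F 𝒯 H) {z : ℂ} (hz : z ∈ juliaSet F 𝒯) :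
    ∃ s, IsExternalAddress 𝒯 s ∧ z ∈ juliaSetAt F 𝒯 s := by
  choose s hs using fun n => hF.exists_tract_of_mem_closure (hz n)
  exact ⟨s, fun n => (hs n).1, hz, fun n => (hs n).2⟩

theorem continuousOn_iterate (hF : IsBLog F 𝒯 H) (n : ℕ) :
    ContinuousOn F^[n] (juliaSet F 𝒯) := by
  cases n with
  | zero => exact continuousOn_id
  | succ n =>
    exact (isClosed_itinerary_and_continuousOn hF.continuous_closure
      (fun _ => isClosed_closure) (fun _ => subset_rfl) n).2.mono fun z hz j _ => hz j

theorem isClosed_controlledSet (hF : IsBLog F 𝒯 H) {D : Set ℂ} (hD : IsClosed D) :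
    IsClosed (controlledSet F 𝒯 D) := by
  have h : controlledSet F 𝒯 D =
      ⋂ n, {z | ∀ j ≤ n, F^[j] z ∈ {w ∈ closure 𝒯 | 1 ≤ j → w ∈ D}} := by
    ext z
    simp only [mem_iInter]
    exact ⟨fun h n j _ => ⟨h.1 j, h.2 j⟩, fun h => ⟨fun n => (h n n le_rfl).1,
      fun n hn => (h n n le_rfl).2 hn⟩⟩
  rw [h]
  refine isClosed_iInter fun n => (isClosed_itinerary_and_continuousOn hF.continuous_closure
    (fun j => ?_) (fun j w hw => hw.1) n).1
  by_cases hj : 1 ≤ j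
  · convert (isClosed_closure (s := 𝒯)).inter hD using 1
    ext z; simp [hj]
  · convert (isClosed_closure (s := 𝒯)) using 1
    ext z; simp [hj]

theorem isClosed_itinerary (hF : IsBLog F 𝒯 H) {D : Set ℂ} (hD : IsClosed D) {s : ℕ → Set ℂ}
    (hs : IsExternalAddress 𝒯 s) (n : ℕ) :
    IsClosed {z | ∀ j ≤ n, F^[j] z ∈ addressLevel D s j} :=
  (isClosed_itinerary_and_continuousOn hF.continuous_closure
    (fun j => isClosed_addressLevel hD s j) (fun j => addressLevel_subset hs j) n).1

theorem isClosed_controlledSetAt (hF : IsBLog F 𝒯 H) {D : Set ℂ} (hD : IsClosed D)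
    {s : ℕ → Set ℂ} (hs : IsExternalAddress 𝒯 s) : IsClosed (controlledSetAt F D s) := by
  rw [controlledSetAt_eq_iInter]
  exact isClosed_iInter fun n => hF.isClosed_itinerary hD hs n

theorem exists_address_of_mem_controlledSet (hF : IsBLog F 𝒯 H) {D : Set ℂ} {z : ℂ}
    (hz : z ∈ controlledSet F 𝒯 D) :
    ∃ s, IsExternalAddress 𝒯 s ∧ z ∈ controlledSetAt F D s := by
  obtain ⟨s, hs, hzs⟩ := hF.exists_address hz.1
  exact ⟨s, hs, fun n => ⟨hzs.2 n, hz.2 n⟩⟩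

theorem subset_controlledSetAt (hF : IsBLog F 𝒯 H) {C D : Set ℂ} {s : ℕ → Set ℂ}
    (hs : IsExternalAddress 𝒯 s) (hC : IsPreconnected C) (hCD : C ⊆ controlledSet F 𝒯 D) {z : ℂ}
    (hzC : z ∈ C) (hzs : z ∈ controlledSetAt F D s) : C ⊆ controlledSetAt F D s := by
  intro w hw n
  refine ⟨?_, fun hn => (hCD hw).2 n hn⟩
  have h1 : IsPreconnected (F^[n] '' C) :=
    hC.image _ ((hF.continuousOn_iterate n).mono fun u hu => (hCD hu).1)
  refine hF.subset_closure_tract h1 ?_ (hs n) ⟨z, hzC, rfl⟩ (hzs n).1 ⟨w, hw, rfl⟩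
  rintro _ ⟨u, hu, rfl⟩
  exact (hCD hu).1 n

/-- By boundary bumping the component of `z` in the finite part is unbounded. It has constant
address, so `z` is connected to ∞ already within the points of address `s`. -/
theorem mem_componentAtInfty_controlledSetAt (hF : IsBLog F 𝒯 H) {D : Set ℂ} (hD : IsClosed D)
    {s : ℕ → Set ℂ} (hs : IsExternalAddress 𝒯 s) {z : ℂ}
    (hz : z ∈ componentAtInfty (controlledSet F 𝒯 D)) (hzs : z ∈ controlledSetAt F D s) :
    z ∈ componentAtInfty (controlledSetAt F D s) := by
  have hX := isClosed_componentAtInfty (hF.isClosed_controlledSet hD)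
  have h1 := not_isBounded_connectedComponentIn hX
    (isPreconnected_withInfty_componentAtInfty _) hz
  refine subset_componentAtInfty (isPreconnected_withInfty
    isPreconnected_connectedComponentIn h1) ?_ (mem_connectedComponentIn hz)
  exact hF.subset_controlledSetAt hs isPreconnected_connectedComponentIn
    ((connectedComponentIn_subset _ _).trans (componentAtInfty_subset _))
    (mem_connectedComponentIn hz) hzs

theorem tendsto_controlledSetAt (hF : IsBLog F 𝒯 H) {D : Set ℂ} (hD : IsClosed D) (hDH : D ⊆ H)
    {s : ℕ → Set ℂ} (hs : IsExternalAddress 𝒯 s) :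
    Tendsto F (cocompact ℂ ⊓ 𝓟 (controlledSetAt F D s)) (cocompact ℂ) :=
  (hF.tendsto_of_mapsTo (hs 0) hD hDH).mono_left (inf_le_inf_left _ (principal_mono.2
    fun _ hz => ⟨(hz 0).1, (hz 1).2 le_rfl⟩))

theorem tendsto_iterate_controlledSetAt (hF : IsBLog F 𝒯 H) {D : Set ℂ} (hD : IsClosed D)
    (hDH : D ⊆ H) {s : ℕ → Set ℂ} (hs : IsExternalAddress 𝒯 s) (n : ℕ) :
    Tendsto F^[n] (cocompact ℂ ⊓ 𝓟 (controlledSetAt F D s)) (cocompact ℂ) := by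
  induction n generalizing s with
  | zero => exact tendsto_id.mono_left inf_le_left
  | succ n ih =>
    rw [Function.iterate_succ]
    refine (ih (hs.shift 1)).comp (tendsto_inf.2 ⟨hF.tendsto_controlledSetAt hD hDH hs, ?_⟩)
    refine tendsto_principal.2 ?_
    filter_upwards [mem_inf_of_right (mem_principal_self _)] with z hz
    exact mapsTo_controlledSetAt hz

theorem tendsto_re_iterate_controlledSetAt (hF : IsBLog F 𝒯 H) {D : Set ℂ} (hD : IsClosed D)
    (hDH : D ⊆ H) {s : ℕ → Set ℂ} (hs : IsExternalAddress 𝒯 s) (n : ℕ) :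
    Tendsto (fun z => (F^[n] z).re) (cocompact ℂ ⊓ 𝓟 (controlledSetAt F D s)) atTop := by
  rw [tendsto_atTop]
  intro x
  have h1 := hF.tendsto_iterate_controlledSetAt hD hDH hs n
  have h2 : (closure (s n) ∩ {z | z.re ≤ x})ᶜ ∈ cocompact ℂ := by
    refine IsCompact.compl_mem_cocompact (Metric.isCompact_of_isClosed_isBounded
      (isClosed_closure.inter (isClosed_le Complex.continuous_re continuous_const))
      (hF.isBounded_closure_tract_inter (hs n) x))
  filter_upwards [h1 h2, mem_inf_of_right (mem_principal_self _)] with z hz hzs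
  by_contra! h
  exact hz ⟨(hzs n).1, h.le⟩

/-- The argument goes through a single address because continuity at ∞ is only available within one
tract; points tending to ∞ through different tracts may have bounded images. -/
theorem mapsTo_componentAtInfty_controlledSet (hF : IsBLog F 𝒯 H) {D : Set ℂ} (hD : IsClosed D)
    (hDH : D ⊆ H) : MapsTo F (componentAtInfty (controlledSet F 𝒯 D))
      (componentAtInfty (controlledSet F 𝒯 D)) := by
  intro z hz
  obtain ⟨s, hs, hzs⟩ := hF.exists_address_of_mem_controlledSet (componentAtInfty_subset _ hz)
  refine componentAtInfty_mono (controlledSetAt_subset (hs.shift 1)) ?_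
  exact mapsTo_componentAtInfty ((hF.continuousOn_closure_tract (hs 0)).mono fun w hw => (hw 0).1)
    (hF.tendsto_controlledSetAt hD hDH hs) mapsTo_controlledSetAt
    (hF.mem_componentAtInfty_controlledSetAt hD hs hz hzs)

theorem exp_apply_add_period (hF : IsBLog F 𝒯 H) (hd : DescendsUnderExp F 𝒯) {z : ℂ}
    (hz : z ∈ closure 𝒯) : Complex.exp (F (z + period 1)) = Complex.exp (F z) := by
  have hper : ∀ w, w + period 1 ∈ closure 𝒯 ↔ w ∈ closure 𝒯 :=
    hF.periodic_domain.closure.add_period_mem_iff 1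
  have h1 : ContinuousOn (fun w => Complex.exp (F (w + period 1))) (closure 𝒯) :=
    Complex.continuous_exp.comp_continuousOn
      (hF.continuous_closure.comp (by fun_prop) fun w hw => (hper w).2 hw)
  have h2 : ContinuousOn (fun w => Complex.exp (F w)) (closure 𝒯) :=
    Complex.continuous_exp.comp_continuousOn hF.continuous_closure
  refine EqOn.of_subset_closure (s := 𝒯) (fun w hw => ?_) h1 h2 subset_closure subset_rfl hz
  simp only [period_one]
  exact hd w hw

theorem exp_apply_add_period_int (hF : IsBLog F 𝒯 H) (hd : DescendsUnderExp F 𝒯) {z : ℂ}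
    (hz : z ∈ closure 𝒯) (k : ℤ) : Complex.exp (F (z + period k)) = Complex.exp (F z) := by
  have hper := hF.periodic_domain.closure.add_period_mem_iff
  induction k using Int.induction_on with
  | zero => rw [period_zero, add_zero]
  | succ n ih =>
    rw [period_add, ← add_assoc, hF.exp_apply_add_period hd ((hper _ _).2 hz), ih]
  | pred n ih =>
    rw [← ih, ← hF.exp_apply_add_period hd ((hper (-↑n - 1) z).2 hz)]
    congr 2
    rw [add_assoc, ← period_add, sub_add_cancel]

/-- Inductively, the two orbits differ by some period at every time, and both the closure of 𝒯 and
`D` are periodic. -/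
theorem add_period_mem_controlledSet (hF : IsBLog F 𝒯 H) (hd : DescendsUnderExp F 𝒯) {D : Set ℂ}
    (hD : IsTwoPiIPeriodic D) {z : ℂ} (hz : z ∈ controlledSet F 𝒯 D) (k : ℤ) :
    z + period k ∈ controlledSet F 𝒯 D := by
  have h1 : ∀ n, ∃ m : ℤ, F^[n] (z + period k) = F^[n] z + period m := by
    intro n
    induction n with
    | zero => exact ⟨k, rfl⟩
    | succ n ih =>
      obtain ⟨m, hm⟩ := ih
      rw [Function.iterate_succ_apply', Function.iterate_succ_apply', hm]
      exact Complex.exp_eq_exp_iff_exists_int.1 (hF.exp_apply_add_period_int hd (hz.1 n) m)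
  refine ⟨fun n => ?_, fun n hn => ?_⟩
  · obtain ⟨m, hm⟩ := h1 n
    rw [hm, hF.periodic_domain.closure.add_period_mem_iff]
    exact hz.1 n
  · obtain ⟨m, hm⟩ := h1 n
    rw [hm, hD.add_period_mem_iff]
    exact hz.2 n hn

theorem isTwoPiIPeriodic_componentAtInfty (hF : IsBLog F 𝒯 H) (hd : DescendsUnderExp F 𝒯)
    {D : Set ℂ} (hD : IsTwoPiIPeriodic D) :
    IsTwoPiIPeriodic (componentAtInfty (controlledSet F 𝒯 D)) := by
  have h1 : ∀ k : ℤ, MapsTo (fun z => z + period k) (componentAtInfty (controlledSet F 𝒯 D))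
      (componentAtInfty (controlledSet F 𝒯 D)) := by
    intro k
    refine mapsTo_componentAtInfty (by fun_prop)
      ((Homeomorph.addRight (period k)).isClosedEmbedding.tendsto_cocompact.mono_left inf_le_left)
      fun z hz => hF.add_period_mem_controlledSet hd hD hz k
  intro z
  rw [← period_one]
  refine ⟨fun hz => ?_, fun hz => h1 1 hz⟩
  have := h1 (-1) hz
  simpa [period_neg] using this

end IsBLog

end Itineraries

/-! ### The speed order and its arcs. -/

section SpeedOrder

variable {F : ℂ → ℂ} {𝒯 H : Set ℂ} {φ : ℝ → ℝ} {s : ℕ → Set ℂ}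

/-- The speed order: the orbit of `w` gains a head start over that of `z`. -/
def Slower (F : ℂ → ℂ) (φ : ℝ → ℝ) (z w : ℂ) : Prop :=
  ∃ k : ℕ, φ (F^[k] z).re < (F^[k] w).re

theorem headStart_persists (hA : ∀ k, PairHeadStart F φ (s k) (s (k + 1))) {z w : ℂ} {k m : ℕ}
    (hz : ∀ n ≤ m, F^[n] z ∈ closure (s n)) (hw : ∀ n ≤ m, F^[n] w ∈ closure (s n))
    (hkm : k ≤ m) (h : φ (F^[k] z).re < (F^[k] w).re) : φ (F^[m] z).re < (F^[m] w).re := by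
  induction m, hkm using Nat.le_induction with
  | base => exact h
  | succ m _ ih =>
    have hz' := hz (m + 1) le_rfl
    have hw' := hw (m + 1) le_rfl
    rw [Function.iterate_succ_apply'] at hz' hw' ⊢
    rw [Function.iterate_succ_apply']
    exact hA m _ (hz m (Nat.le_succ m)) _ (hw m (Nat.le_succ m)) hz' hw'
      (ih (fun n hn => hz n (hn.trans (Nat.le_succ m))) fun n hn => hw n (hn.trans (Nat.le_succ m)))

theorem Slower.eventually (hA : ∀ k, PairHeadStart F φ (s k) (s (k + 1))) {z w : ℂ}
    (hz : ∀ n, F^[n] z ∈ closure (s n)) (hw : ∀ n, F^[n] w ∈ closure (s n))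
    (h : Slower F φ z w) : ∀ᶠ n in atTop, φ (F^[n] z).re < (F^[n] w).re := by
  obtain ⟨k, hk⟩ := h
  filter_upwards [eventually_ge_atTop k] with n hn
    using headStart_persists hA (fun n _ => hz n) (fun n _ => hw n) hn hk

/-- The speed order on the sphere, in which `∞` is the fastest point. -/
def SlowerOnSphere (F : ℂ → ℂ) (φ : ℝ → ℝ) (u v : OnePoint ℂ) : Prop :=
  u.elim False fun z => v.elim True fun w => Slower F φ z w

/-- A bounded version of the real part of the `k`-th iterate, continued to `∞`. -/
noncomputable def orbitHeight (F : ℂ → ℂ) (k : ℕ) (u : OnePoint ℂ) : ℝ :=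
  u.elim (Real.pi / 2) fun z => Real.arctan (F^[k] z).re

/-- The intermediate level `y`, available by continuity of φ, splits the relation into one open
condition on each point. This shows that it is open, including at ∞. -/
theorem slowerOnSphere_iff (hφ : IsHeadStartFunction φ) (u v : OnePoint ℂ) :
    SlowerOnSphere F φ u v ↔ ∃ (k : ℕ) (y : ℝ), orbitHeight F k u < Real.arctan y ∧
      Real.arctan (φ y) < orbitHeight F k v := by
  have hlt : ∀ {a b : ℝ}, Real.arctan a < Real.arctan b ↔ a < b :=
    Real.arctan_strictMono.lt_iff_lt
  induction u using OnePoint.rec with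
  | infty =>
    refine iff_of_false id ?_
    rintro ⟨k, y, h, -⟩
    exact absurd h (not_lt.2 (Real.arctan_lt_pi_div_two y).le)
  | coe z =>
    induction v using OnePoint.rec with
    | infty =>
      refine iff_of_true trivial ⟨0, z.re + 1, hlt.2 (lt_add_one _), Real.arctan_lt_pi_div_two _⟩
    | coe w =>
      constructor
      · rintro ⟨k, hk⟩
        have h1 : ∀ᶠ y in 𝓝[>] (F^[k] z).re, φ y < (F^[k] w).re :=
          (hφ.2.1.tendsto _).mono_left nhdsWithin_le_nhds (Iio_mem_nhds hk)
        obtain ⟨y, hy, hy'⟩ := (h1.and self_mem_nhdsWithin).exists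
        exact ⟨k, y, hlt.2 hy', hlt.2 hy⟩
      · rintro ⟨k, y, h1, h2⟩
        exact ⟨k, (hφ.1 (hlt.1 h1).le).trans_lt (hlt.1 h2)⟩

theorem abs_orbitHeight_le (k : ℕ) (u : OnePoint ℂ) : |orbitHeight F k u| ≤ 2 := by
  have hpi := Real.pi_lt_d2
  induction u using OnePoint.rec with
  | infty =>
    change |Real.pi / 2| ≤ 2
    rw [abs_of_pos (by positivity)]; linarith
  | coe z =>
    change |Real.arctan _| ≤ 2
    rw [abs_le]
    constructor
    · linarith [Real.neg_pi_div_two_lt_arctan (F^[k] z).re]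
    · linarith [Real.arctan_lt_pi_div_two (F^[k] z).re]

theorem orbitHeight_le_of_not_slower (hφ : IsHeadStartFunction φ) {u v : OnePoint ℂ} {k : ℕ} {y : ℝ}
    (hu : orbitHeight F k u < Real.arctan y) (huv : ¬ SlowerOnSphere F φ u v) :
    orbitHeight F k v ≤ Real.arctan (φ y) := by
  by_contra! h
  exact huv ((slowerOnSphere_iff hφ u v).2 ⟨k, y, hu, h⟩)

/-- Head starts persist, so two of them hold at a common time and compose because φ(x) > x. Totality
is the second clause of the head-start condition. -/
theorem isStrictTotalOrder_slower (hφ : IsHeadStartFunction φ) (hA : AddressHeadStart F 𝒯 φ s)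
    {Y : Set ℂ} (hY : Y ⊆ juliaSetAt F 𝒯 s) :
    IsStrictTotalOrder (withInfty Y) fun u v => SlowerOnSphere F φ u.1 v.1 := by
  have hev : ∀ {z w : ℂ}, z ∈ Y → w ∈ Y → Slower F φ z w →
      ∀ᶠ n in atTop, φ (F^[n] z).re < (F^[n] w).re := fun hz hw h =>
    h.eventually hA.1 (hY hz).2 (hY hw).2
  have hirr : ∀ z, z ∈ Y → ¬ Slower F φ z z := by
    rintro z hz ⟨k, hk⟩
    exact absurd (hφ.2.2 _) (not_lt.2 hk.le)
  have htrans : ∀ {x y z : ℂ}, x ∈ Y → y ∈ Y → z ∈ Y → Slower F φ x y → Slower F φ y z →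
      Slower F φ x z := by
    intro x y z hx hy hz hxy hyz
    obtain ⟨n, h1, h2⟩ := ((hev hx hy hxy).and (hev hy hz hyz)).exists
    exact ⟨n, (h1.trans (hφ.2.2 _)).trans h2⟩
  have hI : ∀ u : withInfty Y, ¬ SlowerOnSphere F φ u.1 u.1 := by
    rintro ⟨u, hu⟩ h
    induction u using OnePoint.rec with
    | infty => exact h
    | coe z => exact hirr z (coe_mem_withInfty.1 hu) h
  have hT : ∀ u v w : withInfty Y, SlowerOnSphere F φ u.1 v.1 → SlowerOnSphere F φ v.1 w.1 →
      SlowerOnSphere F φ u.1 w.1 := by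
    rintro ⟨u, hu⟩ ⟨v, hv⟩ ⟨w, hw⟩ h1 h2
    induction u using OnePoint.rec with
    | infty => exact h1
    | coe x =>
      induction v using OnePoint.rec with
      | infty => exact False.elim h2
      | coe y =>
        induction w using OnePoint.rec with
        | infty => trivial
        | coe z =>
          simp only [coe_mem_withInfty] at hu hv hw
          exact htrans hu hv hw h1 h2
  have hC : ∀ u v : withInfty Y, ¬ SlowerOnSphere F φ u.1 v.1 → ¬ SlowerOnSphere F φ v.1 u.1 →
      u = v := by
    rintro ⟨u, hu⟩ ⟨v, hv⟩ h1 h2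
    induction u using OnePoint.rec with
    | infty =>
      induction v using OnePoint.rec with
      | infty => rfl
      | coe w => exact absurd trivial h2
    | coe z =>
      induction v using OnePoint.rec with
      | infty => exact absurd trivial h1
      | coe w =>
        by_contra hne
        have hzw : z ≠ w := fun h => hne (by subst h; rfl)
        simp only [coe_mem_withInfty] at hu hv
        obtain ⟨M, hM | hM⟩ := hA.2 z (hY hu) w (hY hv) hzw
        · exact h2 ⟨M, hM⟩
        · exact h1 ⟨M, hM⟩
  exact { irrefl := hI, trans := hT, trichotomous := hC }

theorem continuousOn_orbitHeight {Y : Set ℂ} {k : ℕ} (hc : ContinuousOn F^[k] Y)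
    (ht : Tendsto (fun z => (F^[k] z).re) (cocompact ℂ ⊓ 𝓟 Y) atTop) :
    ContinuousOn (orbitHeight F k) (withInfty Y) :=
  continuousOn_onePoint_elim
    (Real.continuous_arctan.comp_continuousOn (Complex.continuous_re.comp_continuousOn hc))
    ((tendsto_nhds_of_tendsto_nhdsWithin Real.tendsto_arctan_atTop).comp ht)

/-- A set of points with common address that is connected through `∞` is an arc to infinity. -/
theorem isArcToInfinityIn_of_slower (hφ : IsHeadStartFunction φ) (hA : AddressHeadStart F 𝒯 φ s)
    {Y E : Set ℂ} (hY : Y ⊆ juliaSetAt F 𝒯 s) (hYc : IsClosed Y)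
    (hYp : IsPreconnected (withInfty Y)) (hne : Y.Nonempty)
    (hc : ∀ k, ContinuousOn F^[k] Y)
    (ht : ∀ k, Tendsto (fun z => (F^[k] z).re) (cocompact ℂ ⊓ 𝓟 Y) atTop)
    (hE : ∀ z ∈ Y, ∀ w ∈ Y, Slower F φ z w → w ∈ E) : IsArcToInfinityIn Y E := by
  classical
  have hsto := isStrictTotalOrder_slower hφ hA hY
  let _ : LinearOrder (withInfty Y) :=
    linearOrderOfSTO fun u v : withInfty Y => SlowerOnSphere F φ u.1 v.1
  have hlt : ∀ u v : withInfty Y, u < v ↔ SlowerOnSphere F φ u.1 v.1 := fun _ _ => Iff.rfl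
  have : CompactSpace (withInfty Y) :=
    isCompact_iff_compactSpace.1 (isClosed_withInfty hYc).isCompact
  have : PreconnectedSpace (withInfty Y) := Subtype.preconnectedSpace hYp
  have hcont : ∀ k, Continuous fun u : withInfty Y => orbitHeight F k u.1 := fun k =>
    (continuousOn_orbitHeight (hc k) (ht k)).domRestrict
  have : OrderClosedTopology (withInfty Y) := by
    refine ⟨?_⟩
    have h1 : {p : withInfty Y × withInfty Y | p.1 ≤ p.2}ᶜ =
        ⋃ (k : ℕ) (y : ℝ), {p | orbitHeight F k p.2.1 < Real.arctan y ∧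
          Real.arctan (φ y) < orbitHeight F k p.1.1} := by
      ext p
      simp only [mem_compl_iff, mem_ofPred_eq, not_le, mem_iUnion, hlt, slowerOnSphere_iff hφ]
    rw [← isOpen_compl_iff, h1]
    refine isOpen_iUnion fun k => isOpen_iUnion fun y => IsOpen.inter ?_ ?_
    · exact isOpen_lt ((hcont k).comp continuous_snd) continuous_const
    · exact isOpen_lt continuous_const ((hcont k).comp continuous_fst)
  obtain ⟨f, hf, hfm⟩ := exists_strictMono_continuous hcont
    (fun k u => abs_orbitHeight_le k u.1) (by
      intro u w huw
      obtain ⟨k, y, h1, h2⟩ := (slowerOnSphere_iff hφ _ _).1 ((hlt u w).1 huw)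
      refine ⟨k, fun v hv => lt_of_le_of_lt ?_ h2⟩
      exact orbitHeight_le_of_not_slower hφ h1 fun h => absurd ((hlt u v).2 h) (not_lt.2 hv))
  let p : withInfty Y := ⟨OnePoint.infty, infty_mem_withInfty Y⟩
  obtain ⟨y, hy⟩ := hne
  obtain ⟨γ, hγc, hγi, hγim, hγt, hγ0⟩ := exists_ray_parametrization hf hfm (p := p)
    (fun u => not_lt.1 fun h => (hlt p u).1 h)
    ⟨⟨y, coe_mem_withInfty.2 hy⟩, fun h => OnePoint.coe_ne_infty y (congrArg Subtype.val h)⟩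
  let Γ : ℝ → ℂ := fun t => (γ t).1.elim 0 id
  have hΓ : ∀ t ∈ Ici (0 : ℝ), ((Γ t : ℂ) : OnePoint ℂ) = (γ t).1 := by
    intro t ht
    have h1 : γ t ≠ p := by
      have : γ t ∈ ({p}ᶜ : Set _) := hγim ▸ mem_image_of_mem γ ht
      exact this
    obtain ⟨z, hz⟩ := OnePoint.ne_infty_iff_exists.1 fun h => h1 (Subtype.ext h)
    simp only [Γ, ← hz]
    rfl
  have hΓY : ∀ t ∈ Ici (0 : ℝ), Γ t ∈ Y := fun t ht =>
    coe_mem_withInfty.1 (hΓ t ht ▸ (γ t).2)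
  refine ⟨Γ, ?_, ?_, ?_, ?_, ?_⟩
  · rw [OnePoint.isOpenEmbedding_coe.isInducing.continuousOn_iff]
    exact (continuous_subtype_val.comp_continuousOn hγc).congr hΓ
  · intro a ha b hb hab
    refine hγi ha hb (Subtype.ext ?_)
    rw [← hΓ a ha, ← hΓ b hb, hab]
  · refine Subset.antisymm (image_subset_iff.2 hΓY) fun z hz => ?_
    have h1 : (⟨z, coe_mem_withInfty.2 hz⟩ : withInfty Y) ∈ γ '' Ici 0 := by
      rw [hγim]
      exact fun h => OnePoint.coe_ne_infty z (congrArg Subtype.val h)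
    obtain ⟨t, ht, hzt⟩ := h1
    refine ⟨t, ht, OnePoint.coe_injective ?_⟩
    rw [hΓ t ht, hzt]
  · rw [← coclosedCompact_eq_cocompact, ← OnePoint.comap_coe_nhds_infty, tendsto_comap_iff]
    refine Tendsto.congr' ?_ ((continuous_subtype_val.tendsto p).comp hγt)
    filter_upwards [eventually_ge_atTop 0] with t ht using (hΓ t ht).symm
  · intro t ht
    refine hE (Γ 0) (hΓY 0 (mem_Ici.2 le_rfl)) (Γ t) (hΓY t (mem_Ici.2 ht.le)) ?_
    have h1 := (hlt _ _).1 (hγ0 t ht)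
    rwa [← hΓ 0 (mem_Ici.2 le_rfl), ← hΓ t (mem_Ici.2 ht.le)] at h1

end SpeedOrder

/-! ### Expansion and escape. -/

section Expansion

variable {F : ℂ → ℂ} {𝒯 H : Set ℂ}

/-- Distinct orbits with the same address that stay in `D` are not simultaneously in a left
half-plane infinitely often. -/
def OrbitsSeparate (F : ℂ → ℂ) (𝒯 D : Set ℂ) : Prop :=
  ∀ s, IsExternalAddress 𝒯 s → ∀ z ∈ controlledSetAt F D s, ∀ w ∈ controlledSetAt F D s, z ≠ w →
    ∀ M : ℝ, ¬ ∃ᶠ n in atTop, (F^[n] z).re ≤ M ∧ (F^[n] w).re ≤ M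

/-- The composition of the inverse branches along the first `n` tracts of `s`. -/
noncomputable def pullback (F : ℂ → ℂ) (s : ℕ → Set ℂ) : ℕ → ℂ → ℂ
  | 0 => id
  | n + 1 => fun ζ => pullback F s n (Function.invFunOn F (s n) ζ)

namespace IsBLog

theorem pullback_iterate (hF : IsBLog F 𝒯 H) {D : Set ℂ} (hDH : D ⊆ H) {s : ℕ → Set ℂ}
    (hs : IsExternalAddress 𝒯 s) {z : ℂ} (hz : z ∈ controlledSetAt F D s) (n : ℕ) :
    pullback F s n (F^[n] z) = z := by
  induction n with
  | zero => rfl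
  | succ n ih =>
    have h1 := hDH ((hz (n + 1)).2 (by omega))
    rw [Function.iterate_succ_apply'] at h1 ⊢
    change pullback F s n (Function.invFunOn F (s n) (F (F^[n] z))) = z
    rw [hF.inverse_apply (hs n) (hz n).1 h1, ih]

/-- Far to the right, the inverse branches are contractions. -/
theorem exists_contraction (hF : IsBLog F 𝒯 H) : ∃ K : ℝ, {z : ℂ | K ≤ z.re} ⊆ H ∧
    ∀ T ∈ tracts 𝒯, ∀ ζ ∈ {z : ℂ | K ≤ z.re}, ∀ ξ ∈ {z : ℂ | K ≤ z.re},
      ‖Function.invFunOn F T ξ - Function.invFunOn F T ζ‖ ≤ 1 / 2 * ‖ξ - ζ‖ := by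
  -- The derivative bound is 96·7 divided by the distance to the line Re z = R, and it drops to 1/2
  -- at distance 1344.
  obtain ⟨R, hR⟩ := hF.halfPlane_subset
  have hsub : {z : ℂ | R + 1344 ≤ z.re} ⊆ H := fun z hz => hR (by
    have : R + 1344 ≤ z.re := hz
    change R < z.re
    linarith)
  refine ⟨R + 1344, hsub, fun T hT ζ hζ ξ hξ => ?_⟩
  refine (convex_halfSpace_re_ge (R + 1344)).norm_image_sub_le_of_norm_deriv_le
    (fun x hx => (hF.differentiableOn_inverse hT).differentiableAt
      (hF.jordan_range.1.mem_nhds (hsub hx))) (fun x hx => ?_) hζ hξ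
  have hx' : R + 1344 ≤ x.re := hx
  have hball : Metric.ball x (x.re - R) ⊆ H := by
    intro y hy
    refine hR ?_
    rw [mem_ball_iff_norm, norm_sub_rev] at hy
    have := (Complex.re_le_norm (x - y)).trans_lt hy
    rw [Complex.sub_re] at this
    change R < y.re
    linarith
  have h1 := norm_deriv_le_of_mapsTo_ball (hF.radius_le_of_ball_subset_tract hT)
    (show 0 < x.re - R by linarith) ((hF.differentiableOn_inverse hT).mono hball)
    fun y hy => hF.inverse_mem hT (hball hy)
  refine h1.trans ?_
  rw [div_le_iff₀ (by linarith)]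
  linarith

/-- When both orbits are to the left of M at time n they lie in the same closed tract, hence at
bounded distance. Pulling back contracts this by 2^(-n), so infinitely many such times would force
`z = w`. -/
theorem orbitsSeparate_of_contraction (hF : IsBLog F 𝒯 H) {D : Set ℂ} (hDH : D ⊆ H)
    (hD : ∀ T ∈ tracts 𝒯, ∀ ζ ∈ D, ∀ ξ ∈ D,
      ‖Function.invFunOn F T ξ - Function.invFunOn F T ζ‖ ≤ 1 / 2 * ‖ξ - ζ‖) :
    OrbitsSeparate F 𝒯 D := by
  intro s hs z hz w hw hzw M hfreq
  have hexp : ∀ n, ‖w - z‖ ≤ (1 / 2) ^ n * ‖F^[n] w - F^[n] z‖ := by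
    intro n
    induction n with
    | zero => simp
    | succ n ih =>
      have hz1 := (hz (n + 1)).2 (by omega)
      have hw1 := (hw (n + 1)).2 (by omega)
      have h1 := hD (s n) (hs n) _ hz1 _ hw1
      have hz2 := hDH hz1
      have hw2 := hDH hw1
      rw [Function.iterate_succ_apply'] at hz2 hw2
      rw [Function.iterate_succ_apply', Function.iterate_succ_apply'] at h1 ⊢
      rw [hF.inverse_apply (hs n) (hz n).1 hz2, hF.inverse_apply (hs n) (hw n).1 hw2] at h1
      calc _ ≤ (1 / 2) ^ n * ‖F^[n] w - F^[n] z‖ := ih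
        _ ≤ (1 / 2) ^ n * (1 / 2 * ‖F (F^[n] w) - F (F^[n] z)‖) := by gcongr
        _ = _ := by ring
  obtain ⟨B, hB⟩ := hF.exists_norm_sub_period_le_of_re_le M
  have hlim : Tendsto (fun n : ℕ => (1 / 2 : ℝ) ^ n * (B + B)) atTop (𝓝 0) := by
    simpa using (tendsto_pow_atTop_nhds_zero_of_lt_one (r := (1 / 2 : ℝ)) (by norm_num)
      (by norm_num)).mul_const (B + B)
  have hpos : 0 < ‖w - z‖ := norm_pos_iff.2 (sub_ne_zero.2 hzw.symm)
  obtain ⟨n, ⟨hnz, hnw⟩, hn⟩ := (hfreq.and_eventually (hlim.eventually (gt_mem_nhds hpos))).exists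
  obtain ⟨k, hk⟩ := hB (s n) (hs n)
  have h1 := hk _ (hz n).1 hnz
  have h2 := hk _ (hw n).1 hnw
  have h3 := norm_sub_le (F^[n] w - period k) (F^[n] z - period k)
  rw [sub_sub_sub_cancel_right] at h3
  have h4 : (1 / 2 : ℝ) ^ n * ‖F^[n] w - F^[n] z‖ ≤ (1 / 2) ^ n * (B + B) := by
    gcongr; linarith
  linarith [hexp n]

/-- Far to the right there is nothing to show; the remaining part is compact modulo 2πi. -/
theorem exists_ball_subset_of_disjointType (hF : IsBLog F 𝒯 H) (hd : closure 𝒯 ⊆ H) :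
    ∃ ε > 0, ∀ z ∈ closure 𝒯, Metric.ball z ε ⊆ H := by
  obtain ⟨R, hR⟩ := hF.halfPlane_subset
  obtain ⟨B, hB⟩ := hF.exists_norm_sub_period_le_of_re_le (R + 1)
  have hcpt : IsCompact (closure 𝒯 ∩ Metric.closedBall 0 B) :=
    (isCompact_closedBall 0 B).inter_left isClosed_closure
  obtain ⟨δ, hδ, hthick⟩ := hcpt.exists_thickening_subset_open hF.jordan_range.1
    (inter_subset_left.trans hd)
  refine ⟨min δ 1, by positivity, fun z hz y hy => ?_⟩
  rw [mem_ball_iff_norm] at hy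
  by_cases hzR : z.re ≤ R + 1
  · obtain ⟨T, hT, hzT⟩ := hF.exists_tract_of_mem_closure hz
    obtain ⟨k, hk⟩ := hB T hT
    have h1 : z + period (-k) ∈ closure 𝒯 ∩ Metric.closedBall 0 B := by
      refine ⟨(hF.periodic_domain.closure.add_period_mem_iff _ _).2 hz, ?_⟩
      rw [mem_closedBall_zero_iff, period_neg, ← sub_eq_add_neg]
      exact hk z hzT hzR
    rw [← hF.periodic_range.add_period_mem_iff (-k)]
    refine hthick (Metric.mem_thickening_iff.2 ⟨_, h1, ?_⟩)
    rw [dist_add_right, dist_eq_norm]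
    exact hy.trans_le (min_le_left _ _)
  · refine hR ?_
    have h1 := (Complex.re_le_norm (z - y)).trans_lt (norm_sub_rev z y ▸ hy)
    rw [Complex.sub_re] at h1
    have h2 := min_le_right δ 1
    change R < y.re
    linarith

/-- A disc in `H` joining two points is mapped into a tract by an inverse branch and can be enlarged
by the factor `l` within `H`. After n pullbacks its radius has grown like l^n, so by Bloch its
marked points are close. Common returns to a left half-plane fall, up to translation, in one compact
set, whose points are joined by boundedly many discs. -/
theorem orbitsSeparate_of_disjointType (hF : IsBLog F 𝒯 H) (hd : closure 𝒯 ⊆ H) :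
    OrbitsSeparate F 𝒯 (closure 𝒯) := by
  intro s hs z hz w hw hzw M hfreq
  obtain ⟨ε, hε, hball⟩ := hF.exists_ball_subset_of_disjointType hd
  -- As 2688 = 2·192·7, the displacement 192·7·(l - 1) in the enlargement equals ε/2.
  set l : ℝ := 1 + ε / 2688 with hl
  have hl1 : 1 < l := by rw [hl]; linarith [show 0 < ε / 2688 by positivity]
  have hsubH : ∀ {T}, T ∈ tracts 𝒯 → T ⊆ H := fun hT =>
    subset_closure.trans ((closure_tract_subset hT).trans hd)
  have hstep : ∀ {T R p q}, T ∈ tracts 𝒯 → 2 ≤ R → JoinedByDisc H R p q →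
      JoinedByDisc H (l * R) (Function.invFunOn F T p) (Function.invFunOn F T q) := by
    intro T R p q hT hR h
    refine (h.comp (hF.differentiableOn_inverse hT)
      (fun ζ hζ => hF.inverse_mem hT hζ)).enlarge (hF.radius_le_of_ball_subset_tract hT)
      (fun y hy => hball y (closure_tract_subset hT (subset_closure hy))) hl1 ?_ hR
    rw [hl]; linarith
  have hpull : ∀ (s : ℕ → Set ℂ), IsExternalAddress 𝒯 s → ∀ n p q R, 2 ≤ R → JoinedByDisc H R p q →
      JoinedByDisc H (l ^ n * R) (pullback F s n p) (pullback F s n q) := by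
    intro s hs n
    induction n with
    | zero => intro p q R _ h; simpa [pullback] using h
    | succ n ih =>
      intro p q R hR h
      have := ih _ _ (l * R) (by nlinarith) (hstep (hs n) hR h)
      rwa [← mul_assoc, ← pow_succ] at this
  obtain ⟨B, hB⟩ := hF.exists_norm_sub_period_le_of_re_le M
  have hQ : IsCompact (closure 𝒯 ∩ Metric.closedBall 0 B) :=
    (isCompact_closedBall 0 B).inter_left isClosed_closure
  obtain ⟨N, hN⟩ := exists_chain_bound hF.jordan_range.1 hF.jordan_range.2.1.isPreconnected hQ
    (inter_subset_left.trans hd)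
  have hlim : Tendsto (fun n : ℕ => (N : ℝ) * (192 * 7 / (l ^ n * 2))) atTop (𝓝 0) := by
    have h1 : Tendsto (fun n : ℕ => l ^ n * 2) atTop atTop :=
      (tendsto_pow_atTop_atTop_of_one_lt hl1).atTop_mul_const (by norm_num)
    simpa using (tendsto_const_nhds.div_atTop h1).const_mul (N : ℝ)
  have hpos : 0 < ‖w - z‖ := norm_pos_iff.2 (sub_ne_zero.2 hzw.symm)
  obtain ⟨m, ⟨hmz, hmw⟩, hm1, hm⟩ := (hfreq.and_eventually ((eventually_ge_atTop 1).and
    ((tendsto_sub_atTop_nat 1).eventually (hlim.eventually (gt_mem_nhds hpos))))).exists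
  -- Of the m pullbacks, n are used for enlargement. The last one, into `s 0`, puts the disc in a
  -- tract, where the Bloch estimate applies.
  obtain ⟨n, rfl⟩ : ∃ n, m = n + 1 := ⟨m - 1, by omega⟩
  rw [Nat.add_sub_cancel] at hm
  obtain ⟨k, hk⟩ := hB (s (n + 1)) (hs _)
  have hmem : ∀ {x}, x ∈ controlledSetAt F (closure 𝒯) s → (F^[n + 1] x).re ≤ M →
      F^[n + 1] x + period (-k) ∈ closure 𝒯 ∩ Metric.closedBall 0 B := by
    intro x hx hxM
    refine ⟨(hF.periodic_domain.closure.add_period_mem_iff _ _).2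
      (closure_tract_subset (hs _) (hx (n + 1)).1), ?_⟩
    rw [mem_closedBall_zero_iff, period_neg, ← sub_eq_add_neg]
    exact hk _ (hx (n + 1)).1 hxM
  have hrec : ∀ {x}, x ∈ controlledSetAt F (closure 𝒯) s →
      Function.invFunOn F (s 0) (pullback F (fun j => s (j + 1)) n
        (F^[n + 1] x + period (-k) + period k)) = x := by
    intro x hx
    rw [period_neg, neg_add_cancel_right, Function.iterate_succ_apply,
      hF.pullback_iterate hd (hs.shift 1) (mapsTo_controlledSetAt hx)]
    exact hF.inverse_apply (hs 0) (hx 0).1 (hd ((hx 1).2 le_rfl))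
  have h1 := hN _ (hmem hz hmz) _ (hmem hw hmw)
    (fun x => Function.invFunOn F (s 0) (pullback F (fun j => s (j + 1)) n (x + period k)))
    (192 * 7 / (l ^ n * 2)) (by positivity) (fun x _ y _ hxy => by
      have h2 : JoinedByDisc H 2 (x + period k) (y + period k) :=
        hxy.comp (G := fun v => v + period k) (by fun_prop)
          fun v hv => (hF.periodic_range.add_period_mem_iff k v).2 hv
      have h3 := (hpull _ (hs.shift 1) n _ _ 2 le_rfl h2).comp (hF.differentiableOn_inverse (hs 0))
        fun ζ hζ => hF.inverse_mem (hs 0) hζ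
      refine h3.norm_sub_le (hF.radius_le_of_ball_subset_tract (hs 0)) ?_
      linarith [one_le_pow₀ hl1.le (n := n)])
  simp only [hrec hz, hrec hw] at h1
  linarith

/-- Whenever the faster point returns to a left half-plane at a late time, the slower one is there
as well; separation forbids this from recurring. -/
theorem mem_escapingSet_of_slower {D : Set ℂ} (hsep : OrbitsSeparate F 𝒯 D) {s : ℕ → Set ℂ}
    (hs : IsExternalAddress 𝒯 s) {φ : ℝ → ℝ} (hφ : IsHeadStartFunction φ)
    (hA : AddressHeadStart F 𝒯 φ s) {z w : ℂ} (hz : z ∈ controlledSetAt F D s)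
    (hw : w ∈ controlledSetAt F D s) (h : Slower F φ z w) : w ∈ escapingSet F 𝒯 := by
  refine ⟨(controlledSetAt_subset_juliaSetAt hs hw).1, tendsto_atTop.2 fun M => ?_⟩
  by_contra hM
  have h1 := h.eventually hA.1 (fun n => (hz n).1) fun n => (hw n).1
  have hne : z ≠ w := by
    rintro rfl
    obtain ⟨k, hk⟩ := h
    exact absurd (hφ.2.2 _) (not_lt.2 hk.le)
  refine hsep s hs z hz w hw hne M (((not_eventually.1 hM).and_eventually h1).mono ?_)
  rintro n ⟨h2, h3⟩
  have h4 := hφ.2.2 (F^[n] z).re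
  exact ⟨by linarith, by linarith⟩

/-- The component of `z` in the whole brush is exactly the set `Y` for its own address: components
have constant address, and `Y` itself is connected once it is known to be an arc. -/
theorem isArcToInfinityIn_component (hF : IsBLog F 𝒯 H) (hhead : HeadStart F 𝒯) {D : Set ℂ}
    (hD : IsClosed D) (hDH : D ⊆ H) (hsep : OrbitsSeparate F 𝒯 D) {z : ℂ}
    (hz : z ∈ componentAtInfty (controlledSet F 𝒯 D)) :
    IsArcToInfinityIn (connectedComponentIn (componentAtInfty (controlledSet F 𝒯 D)) z)
      (escapingSet F 𝒯) := by
  obtain ⟨s, hs, hzs⟩ := hF.exists_address_of_mem_controlledSet (componentAtInfty_subset _ hz)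
  obtain ⟨φ, hφ, hA⟩ := hhead s hs
  have hzY := hF.mem_componentAtInfty_controlledSetAt hD hs hz hzs
  set Y := componentAtInfty (controlledSetAt F D s) with hY
  have hYs : Y ⊆ controlledSetAt F D s := componentAtInfty_subset _
  have hYJ := controlledSetAt_subset_juliaSetAt (F := F) (D := D) hs
  have hYX : Y ⊆ componentAtInfty (controlledSet F 𝒯 D) :=
    componentAtInfty_mono (controlledSetAt_subset hs)
  have harc : IsArcToInfinityIn Y (escapingSet F 𝒯) := by
    refine isArcToInfinityIn_of_slower hφ hA (hYs.trans hYJ)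
      (isClosed_componentAtInfty (hF.isClosed_controlledSetAt hD hs))
      (isPreconnected_withInfty_componentAtInfty _) ⟨z, hzY⟩
      (fun k => (hF.continuousOn_iterate k).mono fun w hw => (hYJ (hYs hw)).1)
      (fun k => (hF.tendsto_re_iterate_controlledSetAt hD hDH hs k).mono_left
        (inf_le_inf_left _ (principal_mono.2 hYs)))
      fun u hu w hw huw => mem_escapingSet_of_slower hsep hs hφ hA (hYs hu) (hYs hw) huw
  convert harc using 1
  refine Subset.antisymm (fun w hw => ?_) ?_
  · refine hF.mem_componentAtInfty_controlledSetAt hD hs (connectedComponentIn_subset _ _ hw) ?_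
    exact hF.subset_controlledSetAt hs isPreconnected_connectedComponentIn
      ((connectedComponentIn_subset _ _).trans (componentAtInfty_subset _))
      (mem_connectedComponentIn hz) hzs hw
  · obtain ⟨γ, hγc, -, hγY, -⟩ := harc
    refine IsPreconnected.subset_connectedComponentIn ?_ hzY hYX
    rw [← hγY]
    exact (convex_Ici 0).isPreconnected.image γ hγc

end IsBLog

end Expansion

/-! ### Pulling back unbounded continua. -/

section Absorption

variable {F : ℂ → ℂ} {𝒯 H : Set ℂ}

namespace IsBLog

theorem isPreconnected_withInfty_pullback (hF : IsBLog F 𝒯 H) {s : ℕ → Set ℂ}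
    (hs : IsExternalAddress 𝒯 s) {Q : ℕ → Set ℂ} (hQH : ∀ n, 1 ≤ n → Q n ⊆ H)
    (hQ : ∀ n, MapsTo (Function.invFunOn F (s n)) (Q (n + 1)) (Q n)) (n : ℕ) {U : Set ℂ}
    (hU : U ⊆ Q n) (hUp : IsPreconnected (withInfty U)) :
    IsPreconnected (withInfty (pullback F s n '' U)) := by
  induction n generalizing U with
  | zero => simpa [pullback] using hUp
  | succ n ih =>
    have hUH := hU.trans (hQH (n + 1) (by omega))
    have h1 : pullback F s (n + 1) '' U =
        pullback F s n '' (Function.invFunOn F (s n) '' U) := by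
      rw [image_image]; rfl
    rw [h1]
    refine ih (image_subset_iff.2 fun ζ hζ => hQ n (hU hζ)) ?_
    exact isPreconnected_withInfty_image ((hF.differentiableOn_inverse (hs n)).continuousOn.mono hUH)
      ((hF.tendsto_inverse (hs n)).mono_left (inf_le_inf_left _ (principal_mono.2 hUH))) hUp

theorem iterate_pullback (hF : IsBLog F 𝒯 H) {s : ℕ → Set ℂ}
    (hs : IsExternalAddress 𝒯 s) {Q : ℕ → Set ℂ} (hQH : ∀ n, 1 ≤ n → Q n ⊆ H)
    (hQ : ∀ n, MapsTo (Function.invFunOn F (s n)) (Q (n + 1)) (Q n)) (n : ℕ) {ζ : ℂ}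
    (hζ : ζ ∈ Q n) : F^[n] (pullback F s n ζ) = ζ ∧ ∀ j ≤ n, F^[j] (pullback F s n ζ) ∈ Q j := by
  induction n generalizing ζ with
  | zero => exact ⟨rfl, fun j hj => by obtain rfl := Nat.le_zero.1 hj; exact hζ⟩
  | succ n ih =>
    obtain ⟨h1, h2⟩ := ih (hQ n hζ)
    have h3 : F^[n + 1] (pullback F s (n + 1) ζ) = ζ := by
      rw [Function.iterate_succ_apply']
      change F (F^[n] (pullback F s n (Function.invFunOn F (s n) ζ))) = ζ
      rw [h1, hF.apply_inverse (hs n) (hQH (n + 1) (by omega) hζ)]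
    refine ⟨h3, fun j hj => ?_⟩
    rcases Nat.le_succ_iff.1 hj with hj | rfl
    · exact h2 j hj
    · rw [h3]; exact hζ

/-- Limits of points in pullbacks of unbounded continua are connected to `∞`. -/
theorem mem_componentAtInfty_of_pullback (hF : IsBLog F 𝒯 H) {D : Set ℂ} (hD : IsClosed D)
    (hDH : D ⊆ H) {s : ℕ → Set ℂ} (hs : IsExternalAddress 𝒯 s) {Q U : ℕ → Set ℂ}
    (hQD : ∀ n, Q n ⊆ addressLevel D s n)
    (hQ : ∀ n, MapsTo (Function.invFunOn F (s n)) (Q (n + 1)) (Q n)) (hU : ∀ n, U n ⊆ Q n)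
    (hUp : ∀ n, IsPreconnected (withInfty (U n))) {b : ℂ}
    (hb : ∀ n, (b : OnePoint ℂ) ∈ closure (⋃ m ≥ n, withInfty (pullback F s m '' U m))) :
    b ∈ componentAtInfty (controlledSetAt F D s) := by
  have hQH : ∀ n, 1 ≤ n → Q n ⊆ H := fun n hn => fun ζ hζ => hDH ((hQD n hζ).2 hn)
  have h1 := mem_connectedComponentIn_iInter
    (W := fun n => withInfty {z | ∀ j ≤ n, F^[j] z ∈ addressLevel D s j})
    (A := fun n => withInfty (pullback F s n '' U n)) (a := OnePoint.infty)
    (fun m n hmn => withInfty_mono fun z hz j hj => hz j (hj.trans hmn))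
    (fun n => (isClosed_withInfty (hF.isClosed_itinerary hD hs n)).isCompact)
    (fun n => withInfty_mono (image_subset_iff.2 fun ζ hζ j hj =>
      hQD j ((hF.iterate_pullback hs hQH hQ n (hU n hζ)).2 j hj)))
    (fun n => hF.isPreconnected_withInfty_pullback hs hQH hQ n (hU n) (hUp n))
    (fun n => infty_mem_withInfty _) hb
  rwa [← withInfty_iInter, ← controlledSetAt_eq_iInter] at h1

/-- Since closed tracts lie in `H`, each can be pulled back whole. Every pullback along the address
of `z` contains `z`, so no limit point has to be identified. -/
theorem componentAtInfty_of_disjointType (hF : IsBLog F 𝒯 H) (hd : closure 𝒯 ⊆ H) :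
    componentAtInfty (controlledSet F 𝒯 (closure 𝒯)) = juliaSet F 𝒯 := by
  refine Subset.antisymm (fun z hz => (componentAtInfty_subset _ hz).1) fun z hz => ?_
  obtain ⟨s, hs, hzs⟩ := hF.exists_address hz
  have hzs' : z ∈ controlledSetAt F (closure 𝒯) s := fun n => ⟨hzs.2 n, fun _ => hz n⟩
  refine componentAtInfty_mono (controlledSetAt_subset hs) ?_
  have hsub : ∀ n, closure (s n) ⊆ closure 𝒯 := fun n => closure_tract_subset (hs n)
  refine hF.mem_componentAtInfty_of_pullback isClosed_closure hd hs
    (Q := fun n => closure (s n)) (U := fun n => closure (s n))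
    (fun n ζ hζ => ⟨hζ, fun _ => hsub n hζ⟩)
    (fun n ζ hζ => subset_closure (hF.inverse_mem (hs n) (hd (hsub _ hζ)))) (fun _ => subset_rfl)
    (fun n => hF.isPreconnected_withInfty_closure_tract (hs n)) fun n => subset_closure ?_
  exact mem_iUnion₂.2 ⟨n, le_rfl, coe_mem_withInfty.2
    ⟨F^[n] z, hzs.2 n, hF.pullback_iterate hd hs hzs' n⟩⟩

/-- Boundary bumping in the closed tract: the part connected to ∞ within the half-plane to the right
of `p` reaches its boundary line. -/
theorem exists_mem_componentAtInfty_tract (hF : IsBLog F 𝒯 H) {T : Set ℂ} (hT : T ∈ tracts 𝒯)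
    {p : ℂ} (hp : p ∈ closure T) :
    ∃ a ∈ componentAtInfty (closure T ∩ {z | p.re ≤ z.re}), a.re = p.re := by
  have hpre := hF.isPreconnected_withInfty_closure_tract hT
  by_cases h : closure T ⊆ {z | p.re ≤ z.re}
  · exact ⟨p, subset_componentAtInfty hpre (subset_inter subset_rfl h) hp, rfl⟩
  · obtain ⟨a, ha, haO⟩ := exists_mem_componentAtInfty_notMem (O := {z | p.re < z.re})
      isClosed_closure hpre (isClosed_le continuous_const Complex.continuous_re)
      (isOpen_lt continuous_const Complex.continuous_re)
      (fun z (hz : p.re < z.re) => show p.re ≤ z.re from hz.le)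
      ((hF.isBounded_closure_tract_inter hT p.re).subset fun z hz =>
        ⟨hz.1, show z.re ≤ p.re from not_lt.1 hz.2⟩) h
    exact ⟨a, ha, le_antisymm (not_lt.1 haO) (componentAtInfty_subset _ ha).2⟩

/-- Points whose orbits stay far to the right lie on arcs to infinity. -/
theorem mem_componentAtInfty_of_headStart (hF : IsBLog F 𝒯 H) {K : ℝ}
    (hKH : {z : ℂ | K ≤ z.re} ⊆ H) {s : ℕ → Set ℂ} (hs : IsExternalAddress 𝒯 s) {φ ψ : ℝ → ℝ}
    (hφ : IsHeadStartFunction φ) (hφA : ∀ k, PairHeadStart F φ (s k) (s (k + 1)))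
    (hψ : IsHeadStartFunction ψ) (hψA : AddressHeadStart F 𝒯 ψ s) {z : ℂ}
    (hz : z ∈ juliaSetAt F 𝒯 s) (hzK : ∀ n, 1 ≤ n → φ K < (F^[n] z).re) :
    z ∈ componentAtInfty (controlledSet F 𝒯 {z | K ≤ z.re}) := by
  have hDc : IsClosed {z : ℂ | K ≤ z.re} := isClosed_le continuous_const Complex.continuous_re
  -- The points over which the orbit of `z` has no φ-head start at time n. By contraposition of the
  -- head-start condition the inverse branches preserve these sets, and φ(K) < Re F^n(z) keeps them
  -- in the half-plane for n ≥ 1.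
  set Q : ℕ → Set ℂ := fun n => {ζ ∈ closure (s n) | (F^[n] z).re ≤ φ ζ.re} with hQdef
  have hQD : ∀ n, Q n ⊆ addressLevel {z | K ≤ z.re} s n := by
    refine fun n ζ hζ => ⟨hζ.1, fun hn => ?_⟩
    by_contra h
    exact absurd ((hzK n hn).trans_le hζ.2) (not_lt.2 (hφ.1 (not_le.1 h).le))
  have hQH : ∀ n, 1 ≤ n → Q n ⊆ H := fun n hn => fun ζ hζ => hKH ((hQD n hζ).2 hn)
  have hQ : ∀ n, MapsTo (Function.invFunOn F (s n)) (Q (n + 1)) (Q n) := by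
    intro n ζ hζ
    have hζH := hQH (n + 1) (by omega) hζ
    have hmem := subset_closure (hF.inverse_mem (hs n) hζH)
    have happ := hF.apply_inverse (hs n) hζH
    refine ⟨hmem, ?_⟩
    by_contra! h
    have hzn := hz.2 (n + 1)
    have h2 := hζ.2
    rw [Function.iterate_succ_apply'] at hzn h2
    have h1 := hφA n _ hmem _ (hz.2 n) (by rw [happ]; exact hζ.1) hzn h
    rw [happ] at h1
    exact absurd h1 (not_lt.2 h2)
  choose a haU hare using fun n => hF.exists_mem_componentAtInfty_tract (hs n) (hz.2 n)
  set U : ℕ → Set ℂ := fun n => componentAtInfty (closure (s n) ∩ {w | (F^[n] z).re ≤ w.re})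
    with hUdef
  have hU : ∀ n, U n ⊆ Q n := fun n ζ hζ =>
    ⟨(componentAtInfty_subset _ hζ).1, (componentAtInfty_subset _ hζ).2.trans (hφ.2.2 _).le⟩
  set b : ℕ → ℂ := fun n => pullback F s n (a n) with hbdef
  have hbn : ∀ n, F^[n] (b n) = a n ∧ ∀ j ≤ n, F^[j] (b n) ∈ Q j := fun n =>
    hF.iterate_pullback hs hQH hQ n (hU n (haU n))
  -- The real parts agree at time n, so by persistence neither orbit can have had a ψ-head start at
  -- an earlier time.
  have hclose : ∀ n, ∀ j ≤ n, (F^[j] (b n)).re ≤ ψ (F^[j] z).re ∧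
      (F^[j] z).re ≤ ψ (F^[j] (b n)).re := by
    intro n j hj
    have hre : (F^[n] (b n)).re = (F^[n] z).re := by rw [(hbn n).1]; exact hare n
    constructor
    · by_contra! h
      have h1 := headStart_persists hψA.1 (fun i _ => hz.2 i)
        (fun i hi => ((hbn n).2 i hi).1) hj h
      rw [hre] at h1
      exact absurd (hψ.2.2 _) (not_lt.2 h1.le)
    · by_contra! h
      have h1 := headStart_persists hψA.1 (fun i hi => ((hbn n).2 i hi).1)
        (fun i _ => hz.2 i) hj h
      rw [hre] at h1
      exact absurd (hψ.2.2 _) (not_lt.2 h1.le)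
  set E : ℕ → Set ℂ := fun j => {ζ ∈ closure (s j) | ζ.re ≤ ψ (F^[j] z).re ∧ (F^[j] z).re ≤ ψ ζ.re}
    with hEdef
  have hEc : ∀ j, IsClosed (E j) := fun j => isClosed_closure.inter
    ((isClosed_le Complex.continuous_re continuous_const).inter
      (isClosed_le continuous_const (hψ.2.1.comp Complex.continuous_re)))
  have hEb : ∀ n, ∀ j ≤ n, F^[j] (b n) ∈ E j := fun n j hj =>
    ⟨((hbn n).2 j hj).1, hclose n j hj⟩
  have hcpt : IsCompact (E 0) := by
    refine Metric.isCompact_of_isClosed_isBounded (hEc 0)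
      ((hF.isBounded_closure_tract_inter (hs 0) (ψ z.re)).subset fun ζ hζ => ⟨hζ.1, hζ.2.1⟩)
  obtain ⟨c, -, θ, hθ, hlim⟩ := hcpt.tendsto_subseq fun n => hEb n 0 (Nat.zero_le n)
  have hlim' : Tendsto (fun n => b (θ n)) atTop (𝓝 c) := hlim
  have hcE : ∀ n, F^[n] c ∈ E n := by
    intro n
    have hcl := (isClosed_itinerary_and_continuousOn hF.continuous_closure hEc
      (fun j ζ hζ => closure_tract_subset (hs j) hζ.1) n).1
    refine hcl.mem_of_tendsto hlim' ?_ n le_rfl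
    filter_upwards [hθ.tendsto_atTop.eventually (eventually_ge_atTop n)] with m hm j hj
    exact hEb (θ m) j (hj.trans hm)
  have hcz : c = z := by
    by_contra hne
    obtain ⟨M, hM | hM⟩ := hψA.2 c ⟨fun n => closure_tract_subset (hs n) (hcE n).1,
      fun n => (hcE n).1⟩ z hz hne
    -- The closed conditions `E` pass to the limit `c`: it has address `s`, and neither `c` nor `z`
    -- ever has a head start over the other. The separation clause leaves only c = z.
    · exact absurd hM (not_lt.2 (hcE M).2.1)
    · exact absurd hM (not_lt.2 (hcE M).2.2)
  rw [← hcz]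
  refine componentAtInfty_mono (controlledSetAt_subset hs)
    (hF.mem_componentAtInfty_of_pullback hDc hKH hs hQD hQ hU
      (fun n => isPreconnected_withInfty_componentAtInfty _) fun n => ?_)
  refine mem_closure_of_tendsto ((OnePoint.continuous_coe.tendsto c).comp hlim') ?_
  filter_upwards [hθ.tendsto_atTop.eventually (eventually_ge_atTop n)] with m hm
  exact mem_iUnion₂.2 ⟨θ m, hm, coe_mem_withInfty.2 ⟨a (θ m), haU (θ m), rfl⟩⟩

theorem isAbsorbingBrush_componentAtInfty (hF : IsBLog F 𝒯 H) (hhead : HeadStart F 𝒯) {D : Set ℂ}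
    (hD : IsClosed D) (hDp : IsTwoPiIPeriodic D) (hDH : D ⊆ H) (hsep : OrbitsSeparate F 𝒯 D)
    (habs : ∀ z ∈ escapingSet F 𝒯, ∃ n : ℕ, F^[n] z ∈ componentAtInfty (controlledSet F 𝒯 D))
    (hunif : (∃ φ : ℝ → ℝ, UniformHeadStart F 𝒯 φ) →
      ∃ K' : ℝ, 0 < K' ∧ juliaSetAbove F 𝒯 K' ⊆ componentAtInfty (controlledSet F 𝒯 D)) :
    IsAbsorbingBrush F 𝒯 (componentAtInfty (controlledSet F 𝒯 D)) where
  subset_julia := fun _ hz => (componentAtInfty_subset _ hz).1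
  closed := isClosed_componentAtInfty (hF.isClosed_controlledSet hD)
  periodic := fun hd => hF.isTwoPiIPeriodic_componentAtInfty hd hDp
  forward_invariant := hF.mapsTo_componentAtInfty_controlledSet hD hDH
  component_arc := fun _ hz => hF.isArcToInfinityIn_component hhead hD hDH hsep hz
  absorbs := habs
  uniform_absorbs := hunif

theorem iterate_mem_componentAtInfty (hF : IsBLog F 𝒯 H) (hhead : HeadStart F 𝒯) {K : ℝ}
    (hKH : {z : ℂ | K ≤ z.re} ⊆ H) {z : ℂ} (hz : z ∈ escapingSet F 𝒯) :
    ∃ n : ℕ, F^[n] z ∈ componentAtInfty (controlledSet F 𝒯 {z | K ≤ z.re}) := by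
  obtain ⟨s, hs, hzs⟩ := hF.exists_address hz.1
  obtain ⟨φ, hφ, hφA⟩ := hhead s hs
  obtain ⟨n, hn⟩ := eventually_atTop.1 (hz.2.eventually (eventually_gt_atTop (φ K)))
  -- The time n depends on φ, so φ must belong to the original address. Separation is needed on the
  -- Julia set of the shifted address, which may contain points that are not images of points with
  -- address `s`; hence a second function.
  obtain ⟨ψ, hψ, hψA⟩ := hhead _ (hs.shift n)
  have hit : ∀ m, F^[m] (F^[n] z) = F^[m + n] z := fun m => (Function.iterate_add_apply F m n z).symm
  refine ⟨n, hF.mem_componentAtInfty_of_headStart hKH (hs.shift n) hφ (fun k => ?_) hψ hψA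
    ⟨fun m => ?_, fun m => ?_⟩ fun m _ => ?_⟩
  · have := hφA.1 (k + n)
    rwa [add_right_comm] at this
  · rw [hit]; exact hz.1 _
  · rw [hit]; exact hzs.2 _
  · rw [hit]; exact hn _ (by omega)

theorem juliaSetAbove_subset_componentAtInfty (hF : IsBLog F 𝒯 H) {K : ℝ}
    (hKH : {z : ℂ | K ≤ z.re} ⊆ H) {φ : ℝ → ℝ} (hφ : UniformHeadStart F 𝒯 φ) {K' : ℝ}
    (hK' : φ K < K') :
    juliaSetAbove F 𝒯 K' ⊆ componentAtInfty (controlledSet F 𝒯 {z | K ≤ z.re}) := by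
  intro z hz
  obtain ⟨s, hs, hzs⟩ := hF.exists_address hz.1
  exact hF.mem_componentAtInfty_of_headStart hKH hs hφ.1 (hφ.2 s hs).1 hφ.1 (hφ.2 s hs) hzs
    fun n hn => hK'.trans_le (hz.2 n hn)

end IsBLog

end Absorption

theorem theorem4p7 (F : ℂ → ℂ) (𝒯 H : Set ℂ) (hF : IsBLog F 𝒯 H) (hhead : HeadStart F 𝒯) :
    (∃ X : Set ℂ, IsAbsorbingBrush F 𝒯 X) ∧
      (IsDisjointType 𝒯 H → IsAbsorbingBrush F 𝒯 (juliaSet F 𝒯)) := by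
  constructor
  · obtain ⟨K, hKH, hK⟩ := hF.exists_contraction
    refine ⟨_, hF.isAbsorbingBrush_componentAtInfty hhead
      (isClosed_le continuous_const Complex.continuous_re) (fun z => ?_) hKH
      (hF.orbitsSeparate_of_contraction hKH hK)
      (fun z hz => hF.iterate_mem_componentAtInfty hhead hKH hz) ?_⟩
    · simp only [← period_one, mem_ofPred_eq, Complex.add_re, period_re, add_zero]
    · rintro ⟨φ, hφ⟩
      exact ⟨max (φ K + 1) 1, by positivity, hF.juliaSetAbove_subset_componentAtInfty hKH hφ
        ((lt_add_one _).trans_le (le_max_left _ _))⟩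
  · intro hd
    have hX := hF.componentAtInfty_of_disjointType hd
    rw [← hX]
    -- With D the closure of 𝒯 the brush is all of J(F), so absorption holds at time 0 and any
    -- positive K' works.
    refine hF.isAbsorbingBrush_componentAtInfty hhead isClosed_closure hF.periodic_domain.closure hd
      (hF.orbitsSeparate_of_disjointType hd) (fun z hz => ⟨0, ?_⟩)
      fun _ => ⟨1, one_pos, fun z hz => ?_⟩
    · rw [hX]; exact hz.1
    · rw [hX]; exact hz.1
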